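/- Let $d\ge 0$, and equip $\mathcal O(1)$ on $\mathbb P^d(\mathbb C)$ with the Fubini–Study metric; a section $s\in H^0(\mathbb P^d,\mathcal O(n))=\mathbb C[X_0,\dots,X_d]_n$ has norm $|s(x)|=|s(x_0,\dots,x_d)|\,/\,(|x_0|^2+\dots+|x_d|^2)^{n/2}$ at $x=[x_0:\dots:x_d]$, and $\|s\|=\sup_{x}|s(x)|$. Fix a point $x\in\mathbb P^d(\mathbb C)$ and a basis $Y_1,\dots,Y_{d+1}$ of the space $\mathbb C[X_0,\dots,X_d]_1$ of linear forms such that $Y_1,\dots,Y_d$ span the subspace of forms vanishing at $x$. Let $t_j=Y_j/Y_{d+1}$ $(1\le j\le d)$ be the resulting system of local parameters at $x$, and let $\sigma=Y_{d+1}$ be the resulting local trivialization of $\mathcal O(1)$. Let $U_1,\dots,U_{d+1}$ be the Gram–Schmidt orthonormalization of $Y_1,\dots,Y_{d+1}$ for the Hermitian inner product on linear forms in which $X_0,\dots,X_d$ are orthonormal, and put $\gamma_j=\langle Y_j, U_j\rangle^{-1}$. A section $s\neq0$ of $\mathcal O(n)$ expands at $x$, in the completed local ring, as $s=\big(\sum_{\alpha\in\mathbb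 N^d}a_\alpha t^\alpha\big)\sigma^{n}$; let $\mathrm{ord}(s)$ be the lexicographically smallest $\alpha$ with $a_\alpha\ne0$ (first coordinate most significant), and $\mathrm{lead}(s)=a_{\mathrm{ord}(s)}$. Let $\Delta\subset\mathbb R^d$ be the Okounkov body, i.e. the closure of $\bigcup_{n\ge1}\frac1n\,\mathrm{ord}\big(H^0(\mathbb P^d,\mathcal O(n))\setminus\{0\}\big)$. For $\alpha\in\mathrm{ord}(H^0(\mathbb P^d,\mathcal O(n))\setminus\{0\})$ let $F_n(\alpha)=\sup\{|\mathrm{lead}(s)|/\|s\| : \mathrm{ord}(s)=\alpha\}$. The local Chebyshev transform at $\alpha\in\Delta$ is $c(\alpha)=\lim_{n\to\infty}\frac1n\log F_n(\alpha_n)$, where $\alpha_n\in \mathrm{ord}(H^0(\mathbb P^d,\mathcal O(n))\setminus\{0\})$ for $n\ge1$ and $\alpha_n/n\to\alpha$. Then: 1. $\Delta=\{\alpha\in\mathbb R^d : \alpha_j\ge0 \text{ for all } j,\ \alpha_1+\dots+\alpha_d\le1\}$. 2. Every $\gamma_j$ is a positive real number, and every supremum $F_n(\alpha)$ with $n\ge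 1$ is finite. 3. For every $\alpha\in\Delta$ (boundary points included), sequences $(\alpha_n)$ as above exist, the limit $c(\alpha)$ exists and is the same for all of them, and $$c(\alpha)=\sum_{j=1}^{d+1}\alpha_j\log\gamma_j+\tfrac12 h_d(\alpha),\qquad h_d(\alpha)=\sum_{j=1}^{d+1}\alpha_j\log\frac1{\alpha_j},$$ where $\alpha_{d+1}=1-\sum_{j=1}^d\alpha_j$ and $0\log\frac10=0$. -/

import Mathlib

open scoped LinearAlgebra.Projectivization

noncomputable section

namespace FubiniStudy

/-- The Hermitian space `ℂ^(d+1)` of homogeneous coordinate vectors. -/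
abbrev Coord (d : ℕ) : Type := EuclideanSpace ℂ (Fin (d + 1))

/-- The set of complex points of `d`-dimensional projective space. -/
abbrev ProjPoint (d : ℕ) : Type := ℙ ℂ (Coord d)

/-- The global sections `H⁰(ℙ^d, 𝒪(n)) = ℂ[X_0, …, X_d]_n`: homogeneous forms of degree `n`. -/
abbrev Form (d n : ℕ) : Type := MvPolynomial.homogeneousSubmodule (Fin (d + 1)) ℂ n

/-- The value of a form at a coordinate vector. -/
def evalAt {d n : ℕ} (s : Form d n) (v : Coord d) : ℂ :=
  MvPolynomial.eval (fun i => v i) (s : MvPolynomial (Fin (d + 1)) ℂ)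

lemma evalAt_smul {d n : ℕ} (s : Form d n) (c : ℂ) (v : Coord d) :
    evalAt s (c • v) = c ^ n * evalAt s v := by
  have h : MvPolynomial.IsHomogeneous (s : MvPolynomial (Fin (d + 1)) ℂ) n := s.2
  unfold evalAt
  rw [MvPolynomial.eval_eq', MvPolynomial.eval_eq', Finset.mul_sum]
  refine Finset.sum_congr rfl fun m hm => ?_
  have hdeg : ∑ i, m i = n := by
    have h1 := h (MvPolynomial.mem_support_iff.mp hm)
    rw [Finsupp.weight_apply, Finsupp.sum_fintype] at h1
    · simpa using h1
    · intro i; simp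
  simp only [PiLp.smul_apply, smul_eq_mul, mul_pow, Finset.prod_mul_distrib]
  rw [Finset.prod_pow_eq_pow_sum, hdeg]
  ring

/-- The Fubini–Study norm at the point `p` of a section of `𝒪(n)` (the `n`-th tensor power of the
Fubini–Study metric on `𝒪(1)`): `|s(x_0,…,x_d)| / (|x_0|² + ⋯ + |x_d|²)^(n/2)`. -/
def pointNorm {d n : ℕ} (s : Form d n) (p : ProjPoint d) : ℝ :=
  ‖evalAt s p.rep‖ / ‖p.rep‖ ^ n

/-- The pointwise norm may be computed with any homogeneous coordinates of the point. -/
lemma pointNorm_mk {d n : ℕ} (s : Form d n) (v : Coord d) (hv : v ≠ 0) :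
    pointNorm s (Projectivization.mk ℂ v hv) = ‖evalAt s v‖ / ‖v‖ ^ n := by
  obtain ⟨a, ha⟩ := Projectivization.exists_smul_eq_mk_rep ℂ v hv
  have ha0 : ‖(a : ℂ)‖ ≠ 0 := by simp
  rw [pointNorm, ← ha, Units.smul_def, evalAt_smul, norm_smul, norm_mul, norm_pow, mul_pow,
    mul_div_mul_left _ _ (pow_ne_zero n ha0)]

/-- The supremum norm on `H⁰(ℙ^d, 𝒪(n))` attached to the Fubini–Study metric. -/
def supNorm {d n : ℕ} (s : Form d n) : ℝ := ⨆ p : ProjPoint d, pointNorm s p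

/-- The homogeneous ideal of the point `x`: the polynomials that vanish on the line `x`. -/
def pointIdeal {d : ℕ} (x : ProjPoint d) : Ideal (MvPolynomial (Fin (d + 1)) ℂ) where
  carrier := {f | ∀ v ∈ x.submodule, MvPolynomial.eval (fun i => v i) f = 0}
  add_mem' := fun {f g} hf hg v hv => by
    rw [map_add, hf v hv, hg v hv, add_zero]
  zero_mem' := fun v _ => map_zero _
  smul_mem' := fun c f hf v hv => by
    rw [smul_eq_mul, map_mul, hf v hv, mul_zero]

lemma mem_pointIdeal_iff {d : ℕ} (x : ProjPoint d) (f : MvPolynomial (Fin (d + 1)) ℂ) :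
    f ∈ pointIdeal x ↔ ∀ v ∈ x.submodule, MvPolynomial.eval (fun i => v i) f = 0 := Iff.rfl

instance pointIdeal_isPrime {d : ℕ} (x : ProjPoint d) : (pointIdeal x).IsPrime := by
  let φ : MvPolynomial (Fin (d + 1)) ℂ →ₐ[ℂ] Polynomial ℂ :=
    MvPolynomial.aeval (fun i => Polynomial.C (x.rep i) * Polynomial.X)
  have key : ∀ (f : MvPolynomial (Fin (d + 1)) ℂ) (c : ℂ),
      Polynomial.eval c (φ f) = MvPolynomial.eval (fun i => (c • x.rep) i) f := by
    intro f c
    induction f using MvPolynomial.induction_on with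
    | C a => rw [MvPolynomial.eval_C]; simp only [φ, MvPolynomial.aeval_C]; exact Polynomial.eval_C
    | add p q hp hq => rw [map_add, Polynomial.eval_add, hp, hq, map_add]
    | mul_X p i hp =>
      rw [map_mul, Polynomial.eval_mul, hp, map_mul]
      simp only [φ, MvPolynomial.aeval_X, MvPolynomial.eval_X, PiLp.smul_apply, smul_eq_mul,
        Polynomial.eval_mul, Polynomial.eval_C, Polynomial.eval_X, mul_comm]
  have hker : pointIdeal x = RingHom.ker φ := by
    ext f
    rw [mem_pointIdeal_iff, RingHom.mem_ker]
    constructor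
    · intro h
      refine Polynomial.funext fun c => ?_
      rw [key, Polynomial.eval_zero]
      refine h _ ?_
      rw [Projectivization.submodule_eq]
      exact Submodule.smul_mem _ _ (Submodule.mem_span_singleton_self _)
    · intro h v hv
      rw [Projectivization.submodule_eq] at hv
      obtain ⟨c, rfl⟩ := Submodule.mem_span_singleton.mp hv
      rw [← key, h, Polynomial.eval_zero]
  rw [hker]
  exact RingHom.ker_isPrime φ

attribute [local instance] MvPolynomial.gradedAlgebra

/-- The local ring `𝒪_{ℙ^d, x}`: degree-zero fractions of forms with denominator nonzero at `x`. -/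
abbrev LocalRingAt {d : ℕ} (x : ProjPoint d) : Type :=
  HomogeneousLocalization.AtPrime (MvPolynomial.homogeneousSubmodule (Fin (d + 1)) ℂ)
    (pointIdeal x)

/-- A linear form that does not vanish at `x`; it is a local trivialization of `𝒪(1)` at `x`. -/
abbrev Trivialization {d : ℕ} (x : ProjPoint d) : Type :=
  {σ : Form d 1 // (σ : MvPolynomial (Fin (d + 1)) ℂ) ∉ pointIdeal x}

/-- The germ at `x` of the function `s / σ^n`, for a section `s` of `𝒪(n)`; in other words the
germ of `s` is `germ x σ s • σ^n`. -/
def germ {d n : ℕ} (x : ProjPoint d) (σ : Trivialization x) (s : Form d n) : LocalRingAt x :=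
  HomogeneousLocalization.mk
    { deg := n
      num := s
      den := ⟨(σ.1 : MvPolynomial (Fin (d + 1)) ℂ) ^ n, by
        have h : MvPolynomial.IsHomogeneous (σ.1 : MvPolynomial (Fin (d + 1)) ℂ) 1 := σ.1.2
        have h' := h.pow n
        rw [one_mul] at h'
        exact h'⟩
      den_mem := (pointIdeal x).primeCompl.pow_mem σ.2 n }

/-- The power series `f = ∑ a_α T^α` is the expansion of the germ `g` in the local parameters
`t_1, …, t_d`: for each `N`, the germ `g` agrees with the partial sum `∑_{|α| < N} a_α t^α` modulo
`𝔪_x^N`. Equivalently, `f` is sent to `g` by `ℂ⟦T_1, …, T_d⟧ ≃ 𝒪_x^`, `T_j ↦ t_j`. -/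
def IsExpansion {d : ℕ} {x : ProjPoint d} (t : Fin d → LocalRingAt x) (g : LocalRingAt x)
    (f : MvPowerSeries (Fin d) ℂ) : Prop :=
  ∀ N : ℕ,
    g - ∑ k ∈ Finset.range N, ∑ α ∈ Finset.finsuppAntidiag (Finset.univ : Finset (Fin d)) k,
        (MvPowerSeries.coeff α f) • ∏ j, t j ^ α j
      ∈ IsLocalRing.maximalIdeal (LocalRingAt x) ^ N

/-- The section `s` of `𝒪(n)` has order of vanishing `α` at `x` and leading coefficient `a ≠ 0`:
in the expansion of its germ, `a` is the coefficient of `t^α`, and `α` is the lexicographically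
smallest exponent (first coordinate most significant) with nonzero coefficient. -/
def HasLeadingTerm {d n : ℕ} (x : ProjPoint d) (σ : Trivialization x)
    (t : Fin d → LocalRingAt x) (s : Form d n) (α : Fin d →₀ ℕ) (a : ℂ) : Prop :=
  ∃ f : MvPowerSeries (Fin d) ℂ, IsExpansion t (germ x σ s) f ∧
    MvPowerSeries.coeff α f = a ∧ a ≠ 0 ∧
    ∀ β : Fin d →₀ ℕ, toLex β < toLex α → MvPowerSeries.coeff β f = 0

/-- The set `ord_{x,t}(H⁰(ℙ^d, 𝒪(n)) \ {0})` of orders of vanishing. -/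
def ordSet {d : ℕ} (x : ProjPoint d) (σ : Trivialization x) (t : Fin d → LocalRingAt x)
    (n : ℕ) : Set (Fin d →₀ ℕ) :=
  {α | ∃ s : Form d n, s ≠ 0 ∧ ∃ a : ℂ, HasLeadingTerm x σ t s α a}

/-- The Okounkov body of `𝒪(1)`: the closure of `⋃_{n ≥ 1} (1/n) ord_{x,t}(H⁰(ℙ^d, 𝒪(n)) \ {0})`. -/
def okounkovBody {d : ℕ} (x : ProjPoint d) (σ : Trivialization x) (t : Fin d → LocalRingAt x) :
    Set (Fin d → ℝ) :=
  closure {w | ∃ n : ℕ, 1 ≤ n ∧ ∃ α ∈ ordSet x σ t n, w = fun j => (α j : ℝ) / n}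

/-- The ratios `|lead(s)| / ‖s‖`, over the sections `s` of `𝒪(n)` with order of vanishing `α`. -/
def leadRatios {d : ℕ} (x : ProjPoint d) (σ : Trivialization x) (t : Fin d → LocalRingAt x)
    (n : ℕ) (α : Fin d →₀ ℕ) : Set ℝ :=
  {r | ∃ (s : Form d n) (a : ℂ), HasLeadingTerm x σ t s α a ∧ r = ‖a‖ / supNorm s}

/-- `F_{𝒪(n)}(α)`: the supremum of `|lead(s)| / ‖s‖` over the sections `s` of order `α`. -/
def leadSup {d : ℕ} (x : ProjPoint d) (σ : Trivialization x) (t : Fin d → LocalRingAt x)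
    (n : ℕ) (α : Fin d →₀ ℕ) : ℝ :=
  sSup (leadRatios x σ t n α)

/-- The local Chebyshev transform of the Fubini–Study metric is defined at `w` and equals `c`:
`(1/n) log F_{𝒪(n)}(α_n)` tends to `c` for every sequence of orders `α_n` of sections of `𝒪(n)`
such that `α_n / n` tends to `w`, and there is such a sequence. -/
def HasChebyshevTransformAt {d : ℕ} (x : ProjPoint d) (σ : Trivialization x)
    (t : Fin d → LocalRingAt x) (w : Fin d → ℝ) (c : ℝ) : Prop :=
  (∃ α : ℕ → (Fin d →₀ ℕ), (∀ n, 1 ≤ n → α n ∈ ordSet x σ t n) ∧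
    Filter.Tendsto (fun (n : ℕ) (j : Fin d) => (α n j : ℝ) / n) Filter.atTop (nhds w)) ∧
  ∀ α : ℕ → (Fin d →₀ ℕ), (∀ n, 1 ≤ n → α n ∈ ordSet x σ t n) →
    Filter.Tendsto (fun (n : ℕ) (j : Fin d) => (α n j : ℝ) / n) Filter.atTop (nhds w) →
    Filter.Tendsto (fun n : ℕ => 1 / (n : ℝ) * Real.log (leadSup x σ t n (α n)))
      Filter.atTop (nhds c)

/-- The linear forms that vanish at `x`. -/
def vanishingForms {d : ℕ} (x : ProjPoint d) :
    Submodule ℂ (Form d 1) :=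
  ((pointIdeal x).restrictScalars ℂ).comap
    (MvPolynomial.homogeneousSubmodule (Fin (d + 1)) ℂ 1).subtype

/-- If `Y_1, …, Y_{d+1}` is a basis of the linear forms and `Y_1, …, Y_d` span those that vanish
at `x`, then `Y_{d+1}` is a local trivialization at `x`. -/
def lastTrivialization {d : ℕ} (x : ProjPoint d) (Y : Module.Basis (Fin (d + 1)) ℂ (Form d 1))
    (hY : Submodule.span ℂ (Set.range fun j : Fin d => Y j.castSucc) = vanishingForms x) :
    Trivialization x :=
  ⟨Y (Fin.last d), by
    intro h
    have h1 : Y (Fin.last d) ∈ vanishingForms x := h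
    rw [← hY] at h1
    have h2 := Y.linearIndependent.notMem_span_image
      (s := Set.range (Fin.castSucc : Fin d → Fin (d + 1))) (x := Fin.last d)
      (by rintro ⟨j, hj⟩; exact (Fin.castSucc_lt_last j).ne hj)
    rw [← Set.range_comp] at h2
    exact h2 h1⟩

/-- The local parameters `t_j = Y_j / Y_{d+1}`, for `j = 1, …, d`. -/
def localParams {d : ℕ} (x : ProjPoint d) (Y : Module.Basis (Fin (d + 1)) ℂ (Form d 1))
    (hY : Submodule.span ℂ (Set.range fun j : Fin d => Y j.castSucc) = vanishingForms x)
    (j : Fin d) : LocalRingAt x :=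
  germ x (lastTrivialization x Y hY) (Y j.castSucc)

/-- The coefficient vector of a linear form. The Hermitian inner product on linear forms is the one
of `ℂ^(d+1)` on coefficients, so that `X_0, …, X_d` are orthonormal. -/
def coeffVec {d : ℕ} (f : Form d 1) : Coord d :=
  WithLp.toLp 2 fun i => MvPolynomial.coeff (Finsupp.single i 1)
    (f : MvPolynomial (Fin (d + 1)) ℂ)

/-- The coefficient vector of `U_j`, where `U_1, …, U_{d+1}` is the Gram–Schmidt
orthonormalization of `Y_1, …, Y_{d+1}`. -/
def orthoVec {d : ℕ} (Y : Module.Basis (Fin (d + 1)) ℂ (Form d 1)) (j : Fin (d + 1)) : Coord d :=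
  InnerProductSpace.gramSchmidtNormed ℂ (fun i => coeffVec (Y i)) j

/-- The Gram–Schmidt coefficients `γ_j = ⟨Y_j, U_j⟩⁻¹` (the inner product is real). -/
def gamma {d : ℕ} (Y : Module.Basis (Fin (d + 1)) ℂ (Form d 1)) (j : Fin (d + 1)) : ℝ :=
  (RCLike.re (inner ℂ (coeffVec (Y j)) (orthoVec Y j)))⁻¹

/-- `(α_1, …, α_d) ↦ (α_1, …, α_d, α_{d+1})` with `α_{d+1} = 1 - ∑_{j ≤ d} α_j`. -/
def barycentric {d : ℕ} (α : Fin d → ℝ) : Fin (d + 1) → ℝ :=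
  Fin.snoc (α := fun _ => ℝ) α (1 - ∑ j, α j)

/-- The entropy `∑_{j=1}^{d+1} α_j log (1 / α_j)`, with `0 log (1 / 0) = 0`. -/
def entropy {d : ℕ} (α : Fin d → ℝ) : ℝ :=
  ∑ j, barycentric α j * Real.log (1 / barycentric α j)

end FubiniStudy

end

noncomputable section

namespace FubiniStudy

attribute [local instance] MvPolynomial.gradedAlgebra

/-! The orthonormalized forms $U_1,\dots,U_{d+1}$ serve two purposes at once. They are unitary
coordinates, so they preserve the Fubini–Study norm. They are also triangular with respect to $Y$:
$U_j=\gamma_jY_j+{}$ a combination of $Y_i$ with $i<j$. In the lexicographic order the exponents of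
$t_1,\dots,t_d,1$ decrease, so $U_j/Y_{d+1}$ has leading term $\gamma_jt_j$ (with $t_{d+1}=1$).

Write a section of degree $n$ as $s=P(U)$. Leading terms multiply, and homogeneity makes an exponent
$\beta$ of $P$ recoverable from its first $d$ entries. Hence $\mathrm{ord}(s)$ is the smallest
exponent of $P$ with its last entry dropped, and $\mathrm{lead}(s)=P_\beta\prod_j\gamma_j^{\beta_j}$
(`exists_isLexLead`). All exponents of total degree at most $n$ occur, which gives the simplex.

For the norm, put $B=\prod_j\sqrt{\beta_j/n}^{\,\beta_j}$. The torus $|z_j|=\sqrt{\beta_j/n}$ lies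
in the unit sphere, so Cauchy's estimate gives $|P_\beta|\,B\le\|s\|$ (`norm_coeff_mul_le_supNorm`).
Weighted AM–GM shows that the monomial $U^\beta$ has norm at most $B$ (`supNorm_monomial_le`).
Therefore $F_n(\alpha)=\prod_j\gamma_j^{\beta_j}/B$ exactly (`isGreatest_leadRatios`), and
$\frac1n\log F_n(\alpha)$ is the asserted formula evaluated at $\alpha/n$ (`log_leadSup`). The
formula is continuous on all of $\mathbb R^d$, so the limit follows, boundary included.

Reading off a leading term also requires the expansion of a germ to be unique
(`IsExpansion.unique`), which is proved by mapping the local ring to power series. -/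

/-- `α` is a lower bound for the exponents of `f` in the lexicographic order, and the coefficient
of `f` at `α` is `a` (possibly zero). -/
def IsLexLead {d : ℕ} (f : MvPolynomial (Fin d) ℂ) (α : Fin d →₀ ℕ) (a : ℂ) : Prop :=
  f.coeff α = a ∧ ∀ β : Fin d →₀ ℕ, toLex β < toLex α → f.coeff β = 0

/-! ### Multiplicativity of lexicographic leading terms -/

namespace IsLexLead

variable {d : ℕ} {f g : MvPolynomial (Fin d) ℂ} {α β : Fin d →₀ ℕ} {a b : ℂ}

lemma unique (hf : IsLexLead f α a) (ha : a ≠ 0) (hg : IsLexLead f β b) (hb : b ≠ 0) :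
    α = β ∧ a = b := by
  have h : α = β := by
    rcases lt_trichotomy (toLex α) (toLex β) with h | h | h
    · exact absurd (hf.1.symm.trans (hg.2 _ h)) ha
    · exact toLex.injective h
    · exact absurd (hg.1.symm.trans (hf.2 _ h)) hb
  subst h
  exact ⟨rfl, hf.1.symm.trans hg.1⟩

lemma one : IsLexLead (1 : MvPolynomial (Fin d) ℂ) 0 1 := by
  refine ⟨by simp, fun β hβ => ?_⟩
  rw [MvPolynomial.coeff_one, if_neg]
  rintro rfl
  exact lt_irrefl _ hβ

/-- The lexicographic order is compatible with addition: if $x+y\le\alpha+\beta$ and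
$(x,y)\ne(\alpha,\beta)$, then $x<\alpha$ or $y<\beta$, so one of the two coefficients vanishes. -/
lemma mul (hf : IsLexLead f α a) (hg : IsLexLead g β b) : IsLexLead (f * g) (α + β) (a * b) := by
  have key : ∀ x y : Fin d →₀ ℕ, toLex (x + y) ≤ toLex (α + β) → ¬ (x = α ∧ y = β) →
      f.coeff x * g.coeff y = 0 := by
    intro x y hxy hne
    rw [toLex_add, toLex_add] at hxy
    rcases lt_trichotomy (toLex x) (toLex α) with h | h | h
    · rw [hf.2 x h, zero_mul]
    · have hy : toLex y < toLex β := by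
        rw [h] at hxy
        refine lt_of_le_of_ne (le_of_add_le_add_left hxy) fun h' => hne ⟨toLex.injective h,
          toLex.injective h'⟩
      rw [hg.2 y hy, mul_zero]
    · have hy : toLex y < toLex β := by
        by_contra h'
        exact absurd hxy (not_le_of_gt (add_lt_add_of_lt_of_le h (not_lt.mp h')))
      rw [hg.2 y hy, mul_zero]
  constructor
  · rw [MvPolynomial.coeff_mul, Finset.sum_eq_single (α, β), hf.1, hg.1]
    · rintro ⟨x, y⟩ hxy hne
      refine key x y (by rw [Finset.HasAntidiagonal.mem_antidiagonal.mp hxy]) fun h => hne ?_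
      rw [h.1, h.2]
    · intro h
      exact absurd (Finset.HasAntidiagonal.mem_antidiagonal.mpr (Eq.refl (α + β))) h
  · intro γ hγ
    rw [MvPolynomial.coeff_mul]
    refine Finset.sum_eq_zero ?_
    rintro ⟨x, y⟩ hxy
    have hxy' : x + y = γ := Finset.HasAntidiagonal.mem_antidiagonal.mp hxy
    refine key x y (by rw [hxy']; exact hγ.le) ?_
    rintro ⟨rfl, rfl⟩
    rw [hxy'] at hγ
    exact lt_irrefl _ hγ

lemma pow (hf : IsLexLead f α a) (k : ℕ) : IsLexLead (f ^ k) (k • α) (a ^ k) := by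
  induction k with
  | zero => simpa using one
  | succ k ih => rw [pow_succ, succ_nsmul, pow_succ]; exact ih.mul hf

lemma prod {ι : Type*} (s : Finset ι) (f : ι → MvPolynomial (Fin d) ℂ) (α : ι → Fin d →₀ ℕ)
    (a : ι → ℂ) (h : ∀ i ∈ s, IsLexLead (f i) (α i) (a i)) :
    IsLexLead (∏ i ∈ s, f i) (∑ i ∈ s, α i) (∏ i ∈ s, a i) := by
  classical
  induction s using Finset.induction_on with
  | empty => simpa using one
  | insert i s hi ih =>
    rw [Finset.prod_insert hi, Finset.sum_insert hi, Finset.prod_insert hi]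
    exact (h i (Finset.mem_insert_self _ _)).mul
      (ih fun j hj => h j (Finset.mem_insert_of_mem hj))

end IsLexLead

/-! ### Leading terms of polynomials in triangular linear forms -/

/-- The coordinates of homogeneous forms in the local parameters: `T_1, …, T_d, 1`. -/
def affineCoord (d : ℕ) : Fin (d + 1) → MvPolynomial (Fin d) ℂ :=
  Fin.snoc (α := fun _ => MvPolynomial (Fin d) ℂ) MvPolynomial.X 1

/-- The exponents of `affineCoord`. -/
def affineExp (d : ℕ) : Fin (d + 1) → Fin d →₀ ℕ :=
  Fin.snoc (α := fun _ => Fin d →₀ ℕ) (fun j => Finsupp.single j 1) 0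

lemma affineCoord_eq_monomial {d : ℕ} (j : Fin (d + 1)) :
    affineCoord d j = MvPolynomial.monomial (affineExp d j) 1 := by
  refine Fin.lastCases ?_ (fun i => ?_) j
  · simp [affineCoord, affineExp]
  · simp [affineCoord, affineExp, MvPolynomial.X]

/-- The reversal of order is what matches Gram–Schmidt: a combination of $Y_1,\dots,Y_j$ has its
smallest exponent at $Y_j$. -/
lemma affineExp_strictAnti {d : ℕ} {i j : Fin (d + 1)} (h : i < j) :
    toLex (affineExp d j) < toLex (affineExp d i) := by
  obtain ⟨i, rfl⟩ := Fin.exists_castSucc_eq.mpr (Fin.ne_last_of_lt h)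
  induction j using Fin.lastCases with
  | last => exact Finsupp.lex_def.mpr ⟨i, fun k hk => by simp [affineExp, hk.ne], by
      simp [affineExp]⟩
  | cast j =>
    have := Fin.castSucc_lt_castSucc_iff.mp h
    exact Finsupp.lex_def.mpr ⟨i, fun k hk => by simp [affineExp, hk.ne, (hk.trans this).ne], by
      simp [affineExp, this.ne']⟩

/-- The linear polynomial in the local parameters with given homogeneous coefficients. -/
def affineLinear {d : ℕ} (c : Fin (d + 1) → ℂ) : MvPolynomial (Fin d) ℂ :=
  ∑ j, c j • affineCoord d j

lemma isLexLead_affineLinear {d : ℕ} (c : Fin (d + 1) → ℂ) (j : Fin (d + 1))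
    (hc : ∀ i, j < i → c i = 0) : IsLexLead (affineLinear c) (affineExp d j) (c j) := by
  have hinj : ∀ i, affineExp d i = affineExp d j → i = j := by
    intro i hi
    rcases lt_trichotomy i j with h | h | h
    · exact absurd (affineExp_strictAnti h) (by rw [hi]; exact lt_irrefl _)
    · exact h
    · exact absurd (affineExp_strictAnti h) (by rw [hi]; exact lt_irrefl _)
  simp only [IsLexLead, affineLinear, MvPolynomial.coeff_sum, MvPolynomial.coeff_smul,
    affineCoord_eq_monomial, MvPolynomial.coeff_monomial, smul_eq_mul]
  constructor
  · rw [Finset.sum_eq_single j]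
    · simp
    · intro i _ hi
      rw [if_neg fun h => hi (hinj i h), mul_zero]
    · simp
  · intro β hβ
    refine Finset.sum_eq_zero fun i _ => ?_
    split_ifs with h
    · subst h
      rcases lt_trichotomy i j with h | h | h
      · exact absurd hβ (affineExp_strictAnti h).not_gt
      · subst h; exact absurd hβ (lt_irrefl _)
      · rw [hc i h, zero_mul]
    · rw [mul_zero]

/-- Forgetting the last exponent. -/
def initExp {d : ℕ} (α : Fin (d + 1) →₀ ℕ) : Fin d →₀ ℕ :=
  Finsupp.equivFunOnFinite.symm fun j => α j.castSucc

@[simp] lemma initExp_apply {d : ℕ} (α : Fin (d + 1) →₀ ℕ) (j : Fin d) :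
    initExp α j = α j.castSucc := rfl

lemma sum_smul_affineExp {d : ℕ} (α : Fin (d + 1) →₀ ℕ) :
    ∑ j, α j • affineExp d j = initExp α := by
  rw [Fin.sum_univ_castSucc]
  ext k
  simp [affineExp, Finsupp.single_apply]

lemma aeval_eq_sum_smul {ι A : Type*} [Fintype ι] [CommRing A] [Algebra ℂ A] (g : ι → A)
    (P : MvPolynomial ι ℂ) :
    MvPolynomial.aeval g P = ∑ β ∈ P.support, P.coeff β • ∏ j, g j ^ β j := by
  rw [MvPolynomial.aeval_def, MvPolynomial.eval₂_eq']
  simp only [Algebra.smul_def]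

/-- The leading term of `P(u)`, where the `j`-th linear polynomial `u_j` has no terms after the
`j`-th and `α` is the smallest exponent of the homogeneous polynomial `P`. -/
lemma isLexLead_aeval {d : ℕ} (c : Fin (d + 1) → Fin (d + 1) → ℂ)
    (hc : ∀ i j, i < j → c i j = 0) (P : MvPolynomial (Fin (d + 1)) ℂ) (α : Fin (d + 1) →₀ ℕ)
    (hα : ∀ β ∈ P.support, β = α ∨ toLex (initExp α) < toLex (initExp β)) :
    IsLexLead (MvPolynomial.aeval (fun j => affineLinear (c j)) P) (initExp α)
      (P.coeff α * ∏ j, c j j ^ α j) := by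
  -- By multiplicativity, the monomial of exponent $\beta$ contributes nothing below `initExp β`, so
  -- at `initExp α` only the monomial $\alpha$ survives.
  have hmon : ∀ β : Fin (d + 1) →₀ ℕ,
      IsLexLead (∏ j, affineLinear (c j) ^ β j) (initExp β) (∏ j, c j j ^ β j) := by
    intro β
    rw [← sum_smul_affineExp]
    exact IsLexLead.prod _ _ _ _ fun j _ => (isLexLead_affineLinear (c j) j (hc j)).pow _
  rw [aeval_eq_sum_smul]
  simp only [IsLexLead, MvPolynomial.coeff_sum, MvPolynomial.coeff_smul, smul_eq_mul]
  constructor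
  · rw [Finset.sum_eq_single α]
    · rw [(hmon α).1]
    · intro β hβ hne
      rw [(hmon β).2 _ ((hα β hβ).resolve_left hne), mul_zero]
    · intro h
      rw [MvPolynomial.notMem_support_iff.mp h, zero_mul]
  · intro γ hγ
    refine Finset.sum_eq_zero fun β hβ => ?_
    rw [(hmon β).2 γ, mul_zero]
    rcases hα β hβ with rfl | h
    · exact hγ
    · exact hγ.trans h

lemma aeval_smul_of_isHomogeneous {ι A : Type*} [Fintype ι] [CommRing A] [Algebra ℂ A]
    {P : MvPolynomial ι ℂ} {n : ℕ} (hP : P.IsHomogeneous n) (c : A) (g : ι → A) :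
    MvPolynomial.aeval (fun i => c * g i) P = c ^ n * MvPolynomial.aeval g P := by
  rw [aeval_eq_sum_smul, aeval_eq_sum_smul, Finset.mul_sum]
  refine Finset.sum_congr rfl fun m hm => ?_
  have hdeg : ∑ i, m i = n := by
    have h1 := hP (MvPolynomial.mem_support_iff.mp hm)
    rw [Finsupp.weight_apply, Finsupp.sum_fintype] at h1
    · simpa using h1
    · intro i; simp
  simp only [mul_pow, Finset.prod_mul_distrib]
  rw [Finset.prod_pow_eq_pow_sum, hdeg, mul_smul_comm]

/-! ### Germs of sections in the local ring -/

/-- The localization of the homogeneous coordinate ring at the ideal of `x`. -/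
abbrev ConeRing {d : ℕ} (x : ProjPoint d) : Type := Localization (pointIdeal x).primeCompl

lemma val_sum {d : ℕ} {x : ProjPoint d} {ι : Type*} (s : Finset ι) (f : ι → LocalRingAt x) :
    (∑ i ∈ s, f i).val = ∑ i ∈ s, (f i).val :=
  map_sum (algebraMap (LocalRingAt x) (ConeRing x)) f s

lemma val_prod {d : ℕ} {x : ProjPoint d} {ι : Type*} (s : Finset ι) (f : ι → LocalRingAt x) :
    (∏ i ∈ s, f i).val = ∏ i ∈ s, (f i).val :=
  map_prod (algebraMap (LocalRingAt x) (ConeRing x)) f s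

lemma val_germ {d n : ℕ} {x : ProjPoint d} (σ : Trivialization x) (s : Form d n) :
    (germ x σ s).val = (s : MvPolynomial (Fin (d + 1)) ℂ) •
      (Localization.mk 1 ⟨σ.1, σ.2⟩ : ConeRing x) ^ n := by
  rw [germ, HomogeneousLocalization.val_mk, Localization.mk_pow, one_pow, Localization.smul_mk,
    smul_eq_mul, mul_one]
  rfl

/-- The germ of a form `P(U_1, …, U_{d+1})` is `P(u_1, …, u_{d+1})`, with `u_j` the germ of the
linear form `U_j`. -/
lemma val_germ_aeval {d n : ℕ} {x : ProjPoint d} (σ : Trivialization x)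
    (U : Fin (d + 1) → Form d 1) {P : MvPolynomial (Fin (d + 1)) ℂ} (hP : P.IsHomogeneous n)
    (s : Form d n)
    (hs : (s : MvPolynomial (Fin (d + 1)) ℂ) =
      MvPolynomial.aeval (fun j => (U j : MvPolynomial (Fin (d + 1)) ℂ)) P) :
    (germ x σ s).val = MvPolynomial.aeval (fun j => (germ x σ (U j)).val) P := by
  have h : (fun j => (germ x σ (U j)).val) = fun j =>
      (Localization.mk 1 ⟨σ.1, σ.2⟩ : ConeRing x) *
        algebraMap (MvPolynomial (Fin (d + 1)) ℂ) (ConeRing x) (U j) := by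
    funext j
    rw [val_germ, pow_one, Algebra.smul_def, mul_comm]
  have h2 : MvPolynomial.aeval (fun j =>
      algebraMap (MvPolynomial (Fin (d + 1)) ℂ) (ConeRing x) (U j)) P = algebraMap _ (ConeRing x)
        (MvPolynomial.aeval (fun j => (U j : MvPolynomial (Fin (d + 1)) ℂ)) P) :=
    MvPolynomial.aeval_algebraMap_apply (R := ℂ) (ConeRing x)
      (fun j => (U j : MvPolynomial (Fin (d + 1)) ℂ)) P
  rw [h, aeval_smul_of_isHomogeneous hP, h2, ← hs, val_germ, Algebra.smul_def, mul_comm]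

lemma mk_mem_maximalIdeal_iff {d : ℕ} (x : ProjPoint d)
    (c : HomogeneousLocalization.NumDenSameDeg
      (MvPolynomial.homogeneousSubmodule (Fin (d + 1)) ℂ) (pointIdeal x).primeCompl) :
    HomogeneousLocalization.mk c ∈ IsLocalRing.maximalIdeal (LocalRingAt x) ↔
      (c.num : MvPolynomial (Fin (d + 1)) ℂ) ∈ pointIdeal x := by
  have h : IsUnit (HomogeneousLocalization.mk c : LocalRingAt x) ↔ _ :=
    (HomogeneousLocalization.isUnit_iff_isUnit_val _ (pointIdeal x)
      (HomogeneousLocalization.mk c)).symm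
  rw [IsLocalRing.mem_maximalIdeal, mem_nonunits_iff, h, HomogeneousLocalization.val_mk,
    Localization.mk_eq_mk', IsLocalization.AtPrime.isUnit_mk'_iff _ (pointIdeal x)]
  exact not_not

lemma aeval_X_eq_coe_map {d : ℕ} (q : MvPolynomial (Fin d) ℂ) :
    MvPolynomial.aeval (MvPowerSeries.X : Fin d → MvPowerSeries (Fin d) (RatFunc ℂ)) q =
      (MvPolynomial.map (algebraMap ℂ (RatFunc ℂ)) q : MvPolynomial (Fin d) (RatFunc ℂ)) := by
  induction q using MvPolynomial.induction_on with
  | C a =>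
    rw [MvPolynomial.aeval_C, MvPolynomial.map_C, MvPolynomial.coe_C,
      MvPowerSeries.algebraMap_apply]
  | add p q hp hq => rw [map_add, map_add, hp, hq, MvPolynomial.coe_add]
  | mul_X p i hp => rw [map_mul, map_mul, hp, MvPolynomial.coe_mul, MvPolynomial.aeval_X,
      MvPolynomial.map_X, MvPolynomial.coe_X]

lemma coeff_aeval_X {d : ℕ} (q : MvPolynomial (Fin d) ℂ) (β : Fin d →₀ ℕ) :
    MvPowerSeries.coeff β (MvPolynomial.aeval
      (MvPowerSeries.X : Fin d → MvPowerSeries (Fin d) (RatFunc ℂ)) q) =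
      algebraMap ℂ (RatFunc ℂ) (q.coeff β) := by
  rw [aeval_X_eq_coe_map, MvPolynomial.coeff_coe, MvPolynomial.coeff_map]

section Basis

variable {d : ℕ} (x : ProjPoint d) (Y : Module.Basis (Fin (d + 1)) ℂ (Form d 1))
    (hY : Submodule.span ℂ (Set.range fun j : Fin d => Y j.castSucc) = vanishingForms x)

lemma val_germ_basis (j : Fin (d + 1)) :
    (germ x (lastTrivialization x Y hY) (Y j)).val =
      MvPolynomial.aeval (fun i => (localParams x Y hY i).val) (affineCoord d j) := by
  induction j using Fin.lastCases with
  | last =>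
    simp only [affineCoord, Fin.snoc_last, map_one]
    rw [val_germ, pow_one, Localization.smul_mk, smul_eq_mul, mul_one]
    exact Localization.mk_self
      (⟨_, (lastTrivialization x Y hY).2⟩ : (pointIdeal x).primeCompl)
  | cast j =>
    simp only [affineCoord, Fin.snoc_castSucc, MvPolynomial.aeval_X]
    rfl

lemma val_germ_linear (f : Form d 1) :
    (germ x (lastTrivialization x Y hY) f).val =
      MvPolynomial.aeval (fun i => (localParams x Y hY i).val)
        (affineLinear fun j => Y.repr f j) := by
  conv_lhs => rw [val_germ, ← Y.sum_repr f]
  rw [affineLinear, map_sum, Submodule.coe_sum, Finset.sum_smul]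
  refine Finset.sum_congr rfl fun j _ => ?_
  rw [map_smul, ← val_germ_basis, val_germ, Submodule.coe_smul, smul_assoc]

include hY in
/-- A vector of the line `x` on which `Y_{d+1}` is `1` and hence `f` is its last coordinate. -/
lemma exists_normalized_rep : ∃ v ∈ x.submodule, v ≠ 0 ∧
    ∀ f : Form d 1, evalAt f v = Y.repr f (Fin.last d) := by
  have hrep : x.rep ∈ x.submodule := by
    rw [Projectivization.submodule_eq]; exact Submodule.mem_span_singleton_self _
  have hev : ∀ f : Form d 1, evalAt f x.rep =
      Y.repr f (Fin.last d) * evalAt (Y (Fin.last d)) x.rep := by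
    intro f
    have h0 : ∀ j : Fin d, evalAt (Y j.castSucc) x.rep = 0 := by
      intro j
      have : Y j.castSucc ∈ vanishingForms x := by
        rw [← hY]; exact Submodule.subset_span ⟨j, rfl⟩
      exact this _ hrep
    conv_lhs => rw [← Y.sum_repr f]
    simp only [evalAt] at h0 ⊢
    rw [Submodule.coe_sum, map_sum, Fin.sum_univ_castSucc]
    simp [MvPolynomial.smul_eval, h0]
  have hc : evalAt (Y (Fin.last d)) x.rep ≠ 0 := by
    intro h
    refine (lastTrivialization x Y hY).2 fun v hv => ?_
    rw [Projectivization.submodule_eq] at hv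
    obtain ⟨c, rfl⟩ := Submodule.mem_span_singleton.mp hv
    have := evalAt_smul (Y (Fin.last d)) c x.rep
    rw [h, mul_zero] at this
    exact this
  -- The representative is rescaled so that $Y_{d+1}$ takes the value $1$; the other $Y_j$ vanish on
  -- the line.
  refine ⟨(evalAt (Y (Fin.last d)) x.rep)⁻¹ • x.rep, Submodule.smul_mem _ _ hrep,
    smul_ne_zero (inv_ne_zero hc) x.rep_nonzero, fun f => ?_⟩
  rw [evalAt_smul, hev f, pow_one]
  field_simp

/-! ### Uniqueness of expansions -/

/-- The degree-one form `X_i`. -/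
def coordForm (i : Fin (d + 1)) : Form d 1 := ⟨MvPolynomial.X i, MvPolynomial.isHomogeneous_X ℂ i⟩

/-- The algebra homomorphism from the homogeneous coordinate ring to power series over `ℂ(S)` with
`Y_j ↦ S T_j` for `j ≤ d` and `Y_{d+1} ↦ S`. -/
def coneExpand : MvPolynomial (Fin (d + 1)) ℂ →ₐ[ℂ] MvPowerSeries (Fin d) (RatFunc ℂ) :=
  MvPolynomial.aeval fun i => MvPowerSeries.C (RatFunc.X : RatFunc ℂ) *
    MvPolynomial.aeval (MvPowerSeries.X : Fin d → MvPowerSeries (Fin d) (RatFunc ℂ))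
      (affineLinear fun j => Y.repr (coordForm i) j)

lemma linear_eq_sum (f : Form d 1) :
    f = ∑ i, MvPolynomial.coeff (Finsupp.single i 1) (f : MvPolynomial (Fin (d + 1)) ℂ) •
      coordForm i := by
  ext m
  rw [Submodule.coe_sum, MvPolynomial.coeff_sum]
  simp only [coordForm, Submodule.coe_smul, MvPolynomial.coeff_smul, MvPolynomial.coeff_X,
    smul_eq_mul, mul_ite, mul_one, mul_zero]
  by_cases hm : m.degree = 1
  · obtain ⟨i, rfl⟩ : ∃ i, m = Finsupp.single i 1 := by
      obtain ⟨i, hi⟩ := Finsupp.ne_iff.mp (show m ≠ 0 by rintro rfl; simp at hm)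
      have hle : Finsupp.single i 1 ≤ m :=
        Finsupp.single_le_iff.mpr (Nat.one_le_iff_ne_zero.mpr hi)
      obtain ⟨r, rfl⟩ := exists_add_of_le hle
      rw [map_add, Finsupp.degree_single, Nat.add_eq_left, Finsupp.degree_eq_zero_iff] at hm
      exact ⟨i, by rw [hm, add_zero]⟩
    rw [Finset.sum_eq_single i]
    · simp
    · intro k _ hk
      rw [if_neg]
      intro h
      exact hk (Finsupp.single_left_injective one_ne_zero h)
    · simp
  · have hf : MvPolynomial.IsHomogeneous (f : MvPolynomial (Fin (d + 1)) ℂ) 1 := f.2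
    rw [hf.coeff_eq_zero hm, Finset.sum_eq_zero]
    intro i _
    rw [if_neg]
    rintro rfl
    simp at hm

lemma affineLinear_sum_smul {ι : Type*} (s : Finset ι) (a : ι → ℂ) (c : ι → Fin (d + 1) → ℂ) :
    affineLinear (∑ i ∈ s, a i • c i) = ∑ i ∈ s, a i • affineLinear (c i) := by
  simp only [affineLinear, Finset.smul_sum, Finset.sum_apply, Pi.smul_apply, Finset.sum_smul,
    smul_eq_mul, mul_smul]
  exact Finset.sum_comm

lemma affineLinear_repr_basis (j : Fin (d + 1)) :
    affineLinear (fun i => Y.repr (Y j) i) = affineCoord d j := by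
  rw [affineLinear, Finset.sum_eq_single j]
  · simp
  · intro i _ hi
    rw [Y.repr_self, Finsupp.single_eq_of_ne hi, zero_smul]
  · simp

lemma coneExpand_linear (f : Form d 1) :
    coneExpand Y f = MvPowerSeries.C (RatFunc.X : RatFunc ℂ) *
      MvPolynomial.aeval (MvPowerSeries.X : Fin d → MvPowerSeries (Fin d) (RatFunc ℂ))
        (affineLinear fun j => Y.repr f j) := by
  have h : (fun j => Y.repr f j) = ∑ i, MvPolynomial.coeff (Finsupp.single i 1)
      (f : MvPolynomial (Fin (d + 1)) ℂ) • fun j => Y.repr (coordForm i) j := by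
    conv_lhs => rw [linear_eq_sum f]
    funext j
    simp
  conv_lhs => rw [linear_eq_sum f]
  rw [h, affineLinear_sum_smul, Submodule.coe_sum, map_sum, map_sum, Finset.mul_sum]
  refine Finset.sum_congr rfl fun i _ => ?_
  rw [Submodule.coe_smul, map_smul, map_smul, mul_smul_comm]
  congr 1
  exact MvPolynomial.aeval_X _ i

include hY in
-- Setting $T=0$ restricts $f$ to the line $x$, parametrized by $S\mapsto Sv$, so the constant
-- coefficient is a polynomial in $S$. For inhomogeneous $f\notin$ `pointIdeal x` it is nonzero but
-- may have roots; this is why the scalars are $\mathbb C(S)$, over which every such $f$ becomes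
-- invertible.
lemma constantCoeff_coneExpand_eq_zero_iff (f : MvPolynomial (Fin (d + 1)) ℂ) :
    MvPowerSeries.constantCoeff (coneExpand Y f) = 0 ↔ f ∈ pointIdeal x := by
  obtain ⟨v, hvx, hv0, hv⟩ := exists_normalized_rep x Y hY
  let φ : MvPolynomial (Fin (d + 1)) ℂ →ₐ[ℂ] Polynomial ℂ :=
    MvPolynomial.aeval fun i => Polynomial.C (v i) * Polynomial.X
  have h1 : ∀ f, MvPowerSeries.constantCoeff (coneExpand Y f) =
      algebraMap (Polynomial ℂ) (RatFunc ℂ) (φ f) := by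
    have hlin : ∀ i, (affineLinear fun j => Y.repr (coordForm i) j).coeff 0 = v i := by
      intro i
      have h2 := hv (coordForm i)
      rw [evalAt, coordForm, MvPolynomial.eval_X] at h2
      rw [h2, affineLinear, Fin.sum_univ_castSucc]
      simp [affineCoord, MvPolynomial.coeff_sum, coordForm]
    have h3 : MvPowerSeries.constantCoeff.comp (coneExpand Y).toRingHom =
        (algebraMap (Polynomial ℂ) (RatFunc ℂ)).comp φ.toRingHom := by
      refine MvPolynomial.ringHom_ext (fun a => ?_) fun i => ?_
      · simp only [RingHom.comp_apply, AlgHom.toRingHom_eq_coe, RingHom.coe_coe,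
          ← MvPolynomial.algebraMap_eq, AlgHom.commutes]
        rw [← IsScalarTower.algebraMap_apply]
        rfl
      · simp only [RingHom.comp_apply, AlgHom.toRingHom_eq_coe, RingHom.coe_coe, coneExpand, φ,
          MvPolynomial.aeval_X, map_mul, MvPowerSeries.constantCoeff_C, RatFunc.algebraMap_X]
        rw [← MvPowerSeries.coeff_zero_eq_constantCoeff_apply, coeff_aeval_X, hlin, mul_comm]
        rfl
    exact fun f => DFunLike.congr_fun h3 f
  have key : ∀ c : ℂ, Polynomial.eval c (φ f) = MvPolynomial.eval (fun i => (c • v) i) f := by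
    intro c
    induction f using MvPolynomial.induction_on with
    | C a => rw [MvPolynomial.eval_C]; simp only [φ, MvPolynomial.aeval_C]; exact Polynomial.eval_C
    | add p q hp hq => rw [map_add, Polynomial.eval_add, hp, hq, map_add]
    | mul_X p i hp =>
      rw [map_mul, Polynomial.eval_mul, hp, map_mul]
      simp only [φ, MvPolynomial.aeval_X, MvPolynomial.eval_X, PiLp.smul_apply, smul_eq_mul,
        Polynomial.eval_mul, Polynomial.eval_C, Polynomial.eval_X, mul_comm]
  rw [h1, map_eq_zero_iff _ (RatFunc.algebraMap_injective ℂ), mem_pointIdeal_iff]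
  have hspan : x.submodule = Submodule.span ℂ {v} := by
    rw [Projectivization.submodule_eq] at hvx ⊢
    obtain ⟨c, rfl⟩ := Submodule.mem_span_singleton.mp hvx
    exact (Submodule.span_singleton_smul_eq
      (isUnit_iff_ne_zero.mpr (left_ne_zero_of_smul hv0)) _).symm
  constructor
  · intro h w hw
    rw [hspan] at hw
    obtain ⟨c, rfl⟩ := Submodule.mem_span_singleton.mp hw
    rw [← key, h, Polynomial.eval_zero]
  · intro h
    refine Polynomial.funext fun c => ?_
    rw [key, Polynomial.eval_zero]
    exact h _ (Submodule.smul_mem _ _ hvx)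

/-- `coneExpand`, extended to the local ring of the affine cone. -/
def localExpand : ConeRing x →ₐ[ℂ] MvPowerSeries (Fin d) (RatFunc ℂ) :=
  IsLocalization.liftAlgHom (M := (pointIdeal x).primeCompl) (f := coneExpand Y) fun y => by
    rw [MvPowerSeries.isUnit_iff_constantCoeff, isUnit_iff_ne_zero, Ne,
      constantCoeff_coneExpand_eq_zero_iff x Y hY]
    exact y.2

lemma localExpand_mk_mul (a : MvPolynomial (Fin (d + 1)) ℂ) (b : (pointIdeal x).primeCompl) :
    localExpand x Y hY (Localization.mk a b) * coneExpand Y b = coneExpand Y a := by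
  rw [localExpand, IsLocalization.liftAlgHom_apply, Localization.mk_eq_mk', mul_comm]
  exact (IsLocalization.lift_mk'_spec _ _ _ _).mp rfl |>.symm

/-- The auxiliary variable cancels in a fraction of degree zero: $ST_j/S=T_j$. -/
lemma localExpand_localParams (j : Fin d) :
    localExpand x Y hY (localParams x Y hY j).val = MvPowerSeries.X j := by
  have h := localExpand_mk_mul x Y hY (Y j.castSucc)
    -- The denominator in `germ` is $\sigma^n$, here literally with exponent $1$.
    ⟨_, (pointIdeal x).primeCompl.pow_mem (lastTrivialization x Y hY).2 1⟩
  have hS : (MvPowerSeries.C (RatFunc.X : RatFunc ℂ) : MvPowerSeries (Fin d) (RatFunc ℂ)) ≠ 0 := by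
    rw [Ne, map_eq_zero_iff _ MvPowerSeries.C_injective]
    exact RatFunc.X_ne_zero
  have hlast : coneExpand Y (lastTrivialization x Y hY).1 ^ 1 = MvPowerSeries.C RatFunc.X := by
    rw [pow_one, coneExpand_linear, lastTrivialization, affineLinear_repr_basis]
    simp [affineCoord]
  simp only [map_pow] at h
  rw [hlast, coneExpand_linear, affineLinear_repr_basis, mul_comm] at h
  refine mul_left_cancel₀ hS (Eq.trans h ?_)
  simp [affineCoord]

lemma constantCoeff_localExpand {a : LocalRingAt x}
    (ha : a ∈ IsLocalRing.maximalIdeal (LocalRingAt x)) :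
    MvPowerSeries.constantCoeff (localExpand x Y hY a.val) = 0 := by
  obtain ⟨c, rfl⟩ := HomogeneousLocalization.mk_surjective a
  have ha' := (mk_mem_maximalIdeal_iff x c).mp ha
  have h := congrArg MvPowerSeries.constantCoeff
    (localExpand_mk_mul x Y hY c.num ⟨c.den, c.den_mem⟩)
  rw [map_mul, (constantCoeff_coneExpand_eq_zero_iff x Y hY _).mpr ha'] at h
  exact (mul_eq_zero.mp h).resolve_right fun h' =>
    c.den_mem ((constantCoeff_coneExpand_eq_zero_iff x Y hY _).mp h')

/-- Elements of the maximal ideal map to series without constant term, and orders add at least under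
products. This lets congruences modulo $\mathfrak m_x^N$ be tested on coefficients. -/
lemma le_order_localExpand (N : ℕ) {a : LocalRingAt x}
    (ha : a ∈ IsLocalRing.maximalIdeal (LocalRingAt x) ^ N) :
    (N : ℕ∞) ≤ (localExpand x Y hY a.val).order := by
  induction N generalizing a with
  | zero => simp
  | succ N ih =>
    rw [pow_succ] at ha
    refine Submodule.mul_induction_on ha (fun b hb c hc => ?_) fun b c hb hc => ?_
    · rw [HomogeneousLocalization.val_mul, map_mul]
      refine le_trans ?_ MvPowerSeries.le_order_mul
      push_cast
      exact add_le_add (ih hb) (MvPowerSeries.one_le_order_iff_constCoeff_eq_zero.mpr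
        (constantCoeff_localExpand x Y hY hc))
    · rw [HomogeneousLocalization.val_add, map_add]
      exact le_trans (le_min hb hc) MvPowerSeries.min_order_le_add

lemma IsExpansion.coeff_localExpand {g : LocalRingAt x} {f : MvPowerSeries (Fin d) ℂ}
    (h : IsExpansion (localParams x Y hY) g f) (β : Fin d →₀ ℕ) :
    MvPowerSeries.coeff β (localExpand x Y hY g.val) =
      algebraMap ℂ (RatFunc ℂ) (MvPowerSeries.coeff β f) := by
  -- The congruence modulo $\mathfrak m_x^N$ with $N=|\beta|+1$ is the first one that sees the
  -- coefficient at $\beta$.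
  have h1 := le_order_localExpand x Y hY _ (h (β.degree + 1))
  have h2 := MvPowerSeries.coeff_of_lt_order (d := β) (lt_of_lt_of_le (by
    exact_mod_cast Nat.lt_succ_self _) h1)
  rw [HomogeneousLocalization.val_sub, map_sub, map_sub, sub_eq_zero] at h2
  rw [h2]
  have hterm : ∀ α : Fin d →₀ ℕ, MvPowerSeries.coeff β (localExpand x Y hY
      (MvPowerSeries.coeff α f • ∏ j, localParams x Y hY j ^ α j : LocalRingAt x).val) =
      if α = β then algebraMap ℂ (RatFunc ℂ) (MvPowerSeries.coeff α f) else 0 := by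
    intro α
    have : localExpand x Y hY
        (MvPowerSeries.coeff α f • ∏ j, localParams x Y hY j ^ α j : LocalRingAt x).val =
        MvPolynomial.aeval MvPowerSeries.X
          (MvPolynomial.monomial α (MvPowerSeries.coeff α f)) := by
      rw [HomogeneousLocalization.val_smul, map_smul, val_prod, map_prod,
        MvPolynomial.aeval_monomial, Algebra.smul_def, Finsupp.prod_fintype _ _ (by simp)]
      simp only [HomogeneousLocalization.val_pow, map_pow, localExpand_localParams]
    rw [this, coeff_aeval_X, MvPolynomial.coeff_monomial]
    split_ifs <;> simp
  simp only [val_sum, map_sum, hterm]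
  rw [Finset.sum_eq_single β.degree, Finset.sum_eq_single β, if_pos rfl]
  · intro α _ hα
    rw [if_neg hα]
  · intro h
    refine absurd (Finset.mem_finsuppAntidiag.mpr ⟨?_, Finset.subset_univ _⟩) h
    rw [Finsupp.degree_eq_sum]
  · intro k _ hk
    refine Finset.sum_eq_zero fun α hα => if_neg ?_
    rintro rfl
    rw [Finset.mem_finsuppAntidiag, ← Finsupp.degree_eq_sum] at hα
    exact hk hα.1.symm
  · simp

include hY in
-- Every expansion of $g$ is read off from `localExpand`, since $\mathbb C\to\mathbb C(S)$ is
-- injective.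
lemma IsExpansion.unique {g : LocalRingAt x} {f f' : MvPowerSeries (Fin d) ℂ}
    (h : IsExpansion (localParams x Y hY) g f) (h' : IsExpansion (localParams x Y hY) g f') :
    f = f' := by
  ext β
  exact (algebraMap ℂ (RatFunc ℂ)).injective
    ((h.coeff_localExpand x Y hY β).symm.trans (h'.coeff_localExpand x Y hY β))

/-! ### Existence of expansions for polynomials in the local parameters -/

lemma localParams_mem (j : Fin d) :
    localParams x Y hY j ∈ IsLocalRing.maximalIdeal (LocalRingAt x) := by
  rw [localParams, germ, mk_mem_maximalIdeal_iff]
  have : Y j.castSucc ∈ vanishingForms x := by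
    rw [← hY]; exact Submodule.subset_span ⟨j, rfl⟩
  exact this

/-- After the terms of degree below $N$ are removed, only finitely many monomials in the $t_j$ of
degree at least $N$ remain, and these lie in $\mathfrak m_x^N$. -/
lemma isExpansion_of_val_eq_aeval {g : LocalRingAt x} (q : MvPolynomial (Fin d) ℂ)
    (h : g.val = MvPolynomial.aeval (fun i => (localParams x Y hY i).val) q) :
    IsExpansion (localParams x Y hY) g (q : MvPowerSeries (Fin d) ℂ) := by
  intro N
  set F : (Fin d →₀ ℕ) → LocalRingAt x := fun α =>
    q.coeff α • ∏ j, localParams x Y hY j ^ α j with hF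
  have hg : g = ∑ α ∈ q.support, F α := by
    apply HomogeneousLocalization.val_injective
    rw [h, aeval_eq_sum_smul, val_sum]
    simp only [hF, HomogeneousLocalization.val_smul, val_prod, HomogeneousLocalization.val_pow]
  have hF0 : ∀ α, α ∉ q.support → F α = 0 := by
    intro α hα
    apply HomogeneousLocalization.val_injective
    rw [hF, HomogeneousLocalization.val_smul, MvPolynomial.notMem_support_iff.mp hα, zero_smul,
      HomogeneousLocalization.val_zero]
  have hsum : ∑ k ∈ Finset.range N,
      ∑ α ∈ Finset.finsuppAntidiag (Finset.univ : Finset (Fin d)) k, F α =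
        ∑ α ∈ q.support with α.degree < N, F α := by
    rw [← Finset.sum_fiberwise_of_maps_to (t := Finset.range N) (g := fun α : Fin d →₀ ℕ => α.degree)]
    · refine Finset.sum_congr rfl fun k hk => (Finset.sum_subset ?_ ?_).symm
      · intro α hα
        rw [Finset.mem_filter] at hα
        rw [Finset.mem_finsuppAntidiag, ← Finsupp.degree_eq_sum]
        exact ⟨hα.2, Finset.subset_univ _⟩
      · intro α hα hα'
        refine hF0 α fun h => hα' ?_
        rw [Finset.mem_finsuppAntidiag, ← Finsupp.degree_eq_sum] at hα
        rw [Finset.mem_filter, Finset.mem_filter]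
        exact ⟨⟨h, hα.1 ▸ Finset.mem_range.mp hk⟩, hα.1⟩
    · intro α hα
      exact Finset.mem_range.mpr (Finset.mem_filter.mp hα).2
  simp only [MvPolynomial.coeff_coe]
  rw [hsum, hg, ← Finset.sum_filter_add_sum_filter_not q.support (fun α => α.degree < N),
    add_sub_cancel_left]
  refine Ideal.sum_mem _ fun α hα => ?_
  have hdeg : N ≤ α.degree := not_lt.mp (Finset.mem_filter.mp hα).2
  have hmem : ∏ j, localParams x Y hY j ^ α j ∈ IsLocalRing.maximalIdeal (LocalRingAt x) ^ N := by
    refine Ideal.pow_le_pow_right hdeg ?_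
    rw [Finsupp.degree_eq_sum, ← Finset.prod_pow_eq_pow_sum]
    exact Ideal.prod_mem_prod fun j _ => Ideal.pow_mem_pow (localParams_mem x Y hY j) _
  have hsmul : F α = (q.coeff α • (1 : LocalRingAt x)) * ∏ j, localParams x Y hY j ^ α j := by
    apply HomogeneousLocalization.val_injective
    rw [hF, HomogeneousLocalization.val_mul, HomogeneousLocalization.val_smul,
      HomogeneousLocalization.val_smul, HomogeneousLocalization.val_one, smul_one_mul]
  rw [hsmul]
  exact Ideal.mul_mem_left _ _ hmem

end Basis

/-- The leading term of `P(U_1, …, U_{d+1})` read off in the local parameters. -/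
lemma hasLeadingTerm_iff {d n : ℕ} (x : ProjPoint d) (Y : Module.Basis (Fin (d + 1)) ℂ (Form d 1))
    (hY : Submodule.span ℂ (Set.range fun j : Fin d => Y j.castSucc) = vanishingForms x)
    (U : Fin (d + 1) → Form d 1) {P : MvPolynomial (Fin (d + 1)) ℂ} (hP : P.IsHomogeneous n)
    (s : Form d n)
    (hs : (s : MvPolynomial (Fin (d + 1)) ℂ) =
      MvPolynomial.aeval (fun j => (U j : MvPolynomial (Fin (d + 1)) ℂ)) P)
    (α : Fin d →₀ ℕ) (a : ℂ) :
    HasLeadingTerm x (lastTrivialization x Y hY) (localParams x Y hY) s α a ↔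
      a ≠ 0 ∧ IsLexLead
        (MvPolynomial.aeval (fun j => affineLinear fun i => Y.repr (U j) i) P) α a := by
  have hexp := isExpansion_of_val_eq_aeval x Y hY
    (g := germ x (lastTrivialization x Y hY) s)
    (MvPolynomial.aeval (fun j => affineLinear fun i => Y.repr (U j) i) P) (by
      rw [val_germ_aeval _ U hP s hs, ← AlgHom.comp_apply, MvPolynomial.comp_aeval]
      simp only [val_germ_linear])
  constructor
  · rintro ⟨f, hf, h1, h2, h3⟩
    obtain rfl := hf.unique x Y hY hexp
    simp only [MvPolynomial.coeff_coe] at h1 h3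
    exact ⟨h2, h1, h3⟩
  · rintro ⟨h2, h1, h3⟩
    refine ⟨_, hexp, ?_, h2, ?_⟩
    · rw [MvPolynomial.coeff_coe, h1]
    · intro β hβ
      rw [MvPolynomial.coeff_coe, h3 β hβ]

/-! ### Gram–Schmidt forms as triangular unitary coordinates -/

/-- A linear form is determined by its coefficient vector. -/
def coeffEquiv (d : ℕ) : Form d 1 ≃ₗ[ℂ] Coord d where
  toFun := coeffVec
  map_add' f g := by ext i; simp [coeffVec]
  map_smul' c f := by ext i; simp [coeffVec]
  invFun v := ∑ i, v i • coordForm i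
  left_inv f := (linear_eq_sum f).symm
  right_inv v := by
    ext i
    simp [coeffVec, coordForm, MvPolynomial.coeff_sum, MvPolynomial.coeff_X,
      Finsupp.single_left_inj]

@[simp] lemma coeffEquiv_apply {d : ℕ} (f : Form d 1) : coeffEquiv d f = coeffVec f := rfl

lemma coe_coeffEquiv_symm {d : ℕ} (w : Coord d) :
    ((coeffEquiv d).symm w : MvPolynomial (Fin (d + 1)) ℂ) =
      ∑ i, w i • (MvPolynomial.X i : MvPolynomial (Fin (d + 1)) ℂ) :=
  map_sum (Submodule.subtype _) (fun i => w i • coordForm i) Finset.univ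

lemma evalAt_coeffEquiv_symm {d : ℕ} (w v : Coord d) :
    evalAt ((coeffEquiv d).symm w) v = ∑ i, w i * v i := by
  rw [evalAt, coe_coeffEquiv_symm, map_sum]
  simp only [MvPolynomial.smul_eval, MvPolynomial.eval_X]

section GramSchmidt

variable {d : ℕ} (Y : Module.Basis (Fin (d + 1)) ℂ (Form d 1))

/-- The linear form `U_j`. -/
def orthoForm (j : Fin (d + 1)) : Form d 1 := (coeffEquiv d).symm (orthoVec Y j)

lemma coeffVec_linearIndependent : LinearIndependent ℂ fun i => coeffVec (Y i) :=
  (Y.map (coeffEquiv d)).linearIndependent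

lemma orthonormal_orthoVec : Orthonormal ℂ (orthoVec Y) :=
  InnerProductSpace.gramSchmidtNormed_orthonormal (coeffVec_linearIndependent Y)

/-- The difference between $Y_j$ and its unnormalized Gram–Schmidt vector is orthogonal to that
vector. Hence $\gamma_j$ is the inverse of a length, real and positive. -/
lemma inner_orthoVec (j : Fin (d + 1)) :
    inner ℂ (coeffVec (Y j)) (orthoVec Y j) =
      (‖InnerProductSpace.gramSchmidt ℂ (fun i => coeffVec (Y i)) j‖ : ℂ) := by
  set f := fun i => coeffVec (Y i) with hf
  have hn : (‖InnerProductSpace.gramSchmidt ℂ f j‖ : ℂ) ≠ 0 := by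
    rw [Complex.ofReal_ne_zero, norm_ne_zero_iff]
    exact InnerProductSpace.gramSchmidt_ne_zero j (coeffVec_linearIndependent Y)
  have h : inner ℂ (f j) (InnerProductSpace.gramSchmidt ℂ f j) =
      (‖InnerProductSpace.gramSchmidt ℂ f j‖ : ℂ) ^ 2 := by
    conv_lhs => rw [InnerProductSpace.gramSchmidt_def'' ℂ f j]
    rw [inner_add_left, sum_inner, Finset.sum_eq_zero, add_zero, inner_self_eq_norm_sq_to_K]
    · rfl
    · intro i hi
      rw [inner_smul_left, InnerProductSpace.gramSchmidt_orthogonal ℂ f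
        (Finset.mem_Iio.mp hi).ne, mul_zero]
  change inner ℂ (f j) (orthoVec Y j) = _
  rw [orthoVec, InnerProductSpace.gramSchmidtNormed, inner_smul_right, h]
  change (‖InnerProductSpace.gramSchmidt ℂ f j‖ : ℂ)⁻¹ * _ = _
  field_simp

lemma gamma_eq (j : Fin (d + 1)) :
    gamma Y j = ‖InnerProductSpace.gramSchmidt ℂ (fun i => coeffVec (Y i)) j‖⁻¹ := by
  rw [gamma, inner_orthoVec]
  simp

lemma gamma_pos (j : Fin (d + 1)) : 0 < gamma Y j := by
  rw [gamma_eq, inv_pos, norm_pos_iff]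
  exact InnerProductSpace.gramSchmidt_ne_zero j (coeffVec_linearIndependent Y)

lemma repr_orthoForm (i j : Fin (d + 1)) : Y.repr (orthoForm Y i) j =
    gamma Y i * (Y.map (coeffEquiv d)).repr
      (InnerProductSpace.gramSchmidt ℂ (Y.map (coeffEquiv d)) i) j := by
  have h : orthoVec Y i = (gamma Y i : ℂ) •
      InnerProductSpace.gramSchmidt ℂ (Y.map (coeffEquiv d)) i := by
    rw [gamma_eq, orthoVec, InnerProductSpace.gramSchmidtNormed]
    simp
    rfl
  rw [orthoForm, h, map_smul, map_smul]
  simp [Module.Basis.map_repr]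

lemma repr_orthoForm_of_lt {i j : Fin (d + 1)} (h : i < j) : Y.repr (orthoForm Y i) j = 0 := by
  rw [repr_orthoForm, InnerProductSpace.gramSchmidt_triangular h, mul_zero]

/-- Orthogonalization changes $Y_j$ only by earlier vectors, so its coordinate along $Y_j$ stays
$1$; normalization then multiplies it by $\gamma_j$. -/
lemma repr_orthoForm_self (j : Fin (d + 1)) : Y.repr (orthoForm Y j) j = gamma Y j := by
  set b := Y.map (coeffEquiv d) with hb
  have h0 : ∀ i ∈ Finset.Iio j, b.repr ((Submodule.span ℂ
      {InnerProductSpace.gramSchmidt ℂ b i}).starProjection (b j)) j = 0 := by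
    intro i hi
    rw [Submodule.starProjection_singleton, map_smul, Finsupp.smul_apply,
      InnerProductSpace.gramSchmidt_triangular (Finset.mem_Iio.mp hi), smul_zero]
  rw [repr_orthoForm, ← hb, InnerProductSpace.gramSchmidt_def, map_sub, map_sum,
    Finsupp.sub_apply, Finsupp.finsetSum_apply, Finset.sum_eq_zero h0]
  simp

/-- The vectors `U_1, …, U_{d+1}` as an orthonormal basis. -/
def orthoBasis : OrthonormalBasis (Fin (d + 1)) ℂ (Coord d) :=
  OrthonormalBasis.mk (orthonormal_orthoVec Y)
    ((orthonormal_orthoVec Y).linearIndependent.span_eq_top_of_card_eq_finrank' (by simp)).ge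

/-- The linear forms `U_1, …, U_{d+1}` are unitary coordinates. -/
lemma exists_unitary_coordinates :
    ∃ Φ : Coord d ≃ₗᵢ[ℂ] Coord d, ∀ v k, Φ v k = evalAt (orthoForm Y k) v := by
  -- Evaluation of a linear form is bilinear while the inner product is conjugate-linear in its
  -- first argument, so $U_k(v)=\langle\overline{U_k},v\rangle$ and the orthonormal basis must be
  -- the conjugate one.
  let e : Fin (d + 1) → Coord d := fun k => WithLp.toLp 2 fun i => star (orthoVec Y k i)
  have he : Orthonormal ℂ e := by
    rw [orthonormal_iff_ite]
    intro i j
    have h := orthonormal_iff_ite.mp (orthonormal_orthoVec Y) j i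
    simp only [PiLp.inner_apply, RCLike.inner_apply, e] at h ⊢
    simp only [eq_comm (a := i), ← h]
    refine Finset.sum_congr rfl fun k _ => ?_
    simp [mul_comm]
  let o := OrthonormalBasis.mk he
    (he.linearIndependent.span_eq_top_of_card_eq_finrank' (by simp)).ge
  refine ⟨o.repr, fun v k => ?_⟩
  rw [o.repr_apply_apply, orthoForm, evalAt_coeffEquiv_symm]
  simp only [o, OrthonormalBasis.coe_mk, PiLp.inner_apply, RCLike.inner_apply, e]
  refine Finset.sum_congr rfl fun i _ => ?_
  simp [mul_comm]

/-- Every form of degree `n` is a form of degree `n` in `U_1, …, U_{d+1}`. -/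
lemma exists_eq_aeval_orthoForm {n : ℕ} (s : Form d n) :
    ∃ P : MvPolynomial (Fin (d + 1)) ℂ, P.IsHomogeneous n ∧
      (s : MvPolynomial (Fin (d + 1)) ℂ) =
        MvPolynomial.aeval (fun j => (orthoForm Y j : MvPolynomial (Fin (d + 1)) ℂ)) P := by
  let a : Fin (d + 1) → Fin (d + 1) → ℂ := fun i j =>
    (orthoBasis Y).repr (coeffVec (coordForm i)) j
  have hs : MvPolynomial.IsHomogeneous (s : MvPolynomial (Fin (d + 1)) ℂ) n := s.2
  -- $P$ is obtained by substituting $X_i=\sum_j a_{ij}U_j$ into $s$.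
  refine ⟨MvPolynomial.aeval (fun i => ∑ j, a i j • MvPolynomial.X j) (s : MvPolynomial _ ℂ),
    ?_, ?_⟩
  · have := hs.aeval (R := ℂ) (n := 1)
      (fun i => ∑ j, a i j • (MvPolynomial.X j : MvPolynomial (Fin (d + 1)) ℂ)) fun i => by
        refine MvPolynomial.IsHomogeneous.sum _ _ _ fun j _ => ?_
        exact (MvPolynomial.homogeneousSubmodule (Fin (d + 1)) ℂ 1).smul_mem _
          (MvPolynomial.isHomogeneous_X ℂ j)
    rwa [one_mul] at this
  · have hX : ∀ i, ∑ j, a i j • (orthoForm Y j : MvPolynomial (Fin (d + 1)) ℂ) =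
        MvPolynomial.X i := by
      intro i
      have h : ∑ j, a i j • orthoForm Y j = coordForm i := by
        apply (coeffEquiv d).injective
        rw [map_sum, coeffEquiv_apply, ← (orthoBasis Y).sum_repr (coeffVec (coordForm i))]
        refine Finset.sum_congr rfl fun j _ => ?_
        rw [map_smul, orthoForm, LinearEquiv.apply_symm_apply, orthoBasis,
          OrthonormalBasis.coe_mk]
        rfl
      have := congrArg (Submodule.subtype _) h
      rw [map_sum] at this
      exact this
    rw [← AlgHom.comp_apply, MvPolynomial.comp_aeval]
    simp only [map_sum, map_smul, MvPolynomial.aeval_X, hX]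
    rw [MvPolynomial.aeval_X_left_apply]

end GramSchmidt

/-! ### Sup norms, Cauchy's estimate and the size of monomials -/

lemma norm_evalAt_le {d n : ℕ} (s : Form d n) (v : Coord d) (hv : ‖v‖ = 1) :
    ‖evalAt s v‖ ≤ ∑ m ∈ (s : MvPolynomial (Fin (d + 1)) ℂ).support,
      ‖(s : MvPolynomial (Fin (d + 1)) ℂ).coeff m‖ := by
  rw [evalAt, MvPolynomial.eval_eq']
  refine (norm_sum_le _ _).trans (Finset.sum_le_sum fun m _ => ?_)
  rw [norm_mul, norm_prod]
  refine mul_le_of_le_one_right (norm_nonneg _) (Finset.prod_le_one (fun _ _ => norm_nonneg _)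
    fun i _ => ?_)
  rw [norm_pow]
  exact pow_le_one₀ (norm_nonneg _) (hv ▸ PiLp.norm_apply_le v i)

lemma exists_pointNorm_eq {d n : ℕ} (p : ProjPoint d) :
    ∃ v : Coord d, ‖v‖ = 1 ∧ ∀ s : Form d n, pointNorm s p = ‖evalAt s v‖ := by
  have h0 : ‖p.rep‖ ≠ 0 := norm_ne_zero_iff.mpr p.rep_nonzero
  refine ⟨((‖p.rep‖ : ℂ)⁻¹) • p.rep, ?_, fun s => ?_⟩
  · rw [norm_smul, norm_inv, Complex.norm_real, norm_norm, inv_mul_cancel₀ h0]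
  · rw [pointNorm, evalAt_smul, norm_mul, norm_pow, norm_inv, Complex.norm_real, norm_norm,
      inv_pow, div_eq_inv_mul]

lemma norm_evalAt_le_supNorm {d n : ℕ} (s : Form d n) (v : Coord d) (hv : ‖v‖ = 1) :
    ‖evalAt s v‖ ≤ supNorm s := by
  -- The crude coefficient bound is needed because an unbounded real supremum defaults to $0$.
  have hbdd : BddAbove (Set.range fun p : ProjPoint d => pointNorm s p) := by
    refine ⟨∑ m ∈ (s : MvPolynomial (Fin (d + 1)) ℂ).support,
      ‖(s : MvPolynomial (Fin (d + 1)) ℂ).coeff m‖, ?_⟩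
    rintro _ ⟨p, rfl⟩
    obtain ⟨w, hw, h⟩ := exists_pointNorm_eq (n := n) p
    exact (h s).trans_le (norm_evalAt_le s w hw)
  have hv0 : v ≠ 0 := by rintro rfl; simp at hv
  have h := le_ciSup hbdd (Projectivization.mk ℂ v hv0)
  rwa [pointNorm_mk, hv, one_pow, div_one] at h

lemma supNorm_le {d n : ℕ} (s : Form d n) {C : ℝ} (hC : 0 ≤ C)
    (h : ∀ v : Coord d, ‖v‖ = 1 → ‖evalAt s v‖ ≤ C) : supNorm s ≤ C := by
  refine Real.iSup_le (fun p => ?_) hC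
  obtain ⟨w, hw, hp⟩ := exists_pointNorm_eq (n := n) p
  exact (hp s).trans_le (h w hw)

lemma sum_pow_rootOfUnity {M : ℕ} {ζ : ℂ} (hζ : IsPrimitiveRoot ζ M) {a b : ℕ} (ha : a < M)
    (hb : b < M) :
    ∑ k ∈ Finset.range M, (ζ ^ a * (ζ ^ b)⁻¹) ^ k = if a = b then (M : ℂ) else 0 := by
  have hM : M ≠ 0 := by omega
  have hζ0 : ζ ≠ 0 := hζ.ne_zero hM
  split_ifs with h
  · subst h
    rw [mul_inv_cancel₀ (pow_ne_zero _ hζ0)]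
    simp
  · have hω : ζ ^ a * (ζ ^ b)⁻¹ ≠ 1 := by
      intro h'
      rw [mul_inv_eq_one₀ (pow_ne_zero _ hζ0)] at h'
      exact h (hζ.pow_inj ha hb h')
    have hωM : (ζ ^ a * (ζ ^ b)⁻¹) ^ M = 1 := by
      rw [mul_pow, inv_pow, ← pow_mul, ← pow_mul, mul_comm a, mul_comm b, pow_mul, pow_mul,
        hζ.pow_eq_one, one_pow, one_pow, inv_one, one_mul]
    rw [geom_sum_eq hω, hωM, sub_self, zero_div]

/-- Cauchy's estimate for the coefficients of a polynomial bounded on a torus. -/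
lemma norm_coeff_mul_prod_le {ι : Type*} [Fintype ι] [DecidableEq ι] (P : MvPolynomial ι ℂ)
    (r : ι → ℝ) (hr : ∀ i, 0 ≤ r i) {C : ℝ}
    (hC : ∀ z : ι → ℂ, (∀ i, ‖z i‖ = r i) → ‖MvPolynomial.eval z P‖ ≤ C) (α : ι →₀ ℕ) :
    ‖P.coeff α‖ * ∏ i, r i ^ α i ≤ C := by
  -- $M$ exceeds every entry of $\alpha$ and of the exponents of $P$, so distinct entries give
  -- distinct powers of a primitive $M$-th root of unity.
  set M := P.totalDegree + α.degree + 1 with hMdef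
  have hM : M ≠ 0 := by omega
  set ζ := Complex.exp (2 * Real.pi * Complex.I / M) with hζdef
  have hζ : IsPrimitiveRoot ζ M := Complex.isPrimitiveRoot_exp M hM
  have hζn : ‖ζ‖ = 1 := hζ.norm'_eq_one hM
  have hα : ∀ i, α i < M := fun i => by
    have := Finsupp.le_degree i α
    omega
  have hβ : ∀ β ∈ P.support, ∀ i, β i < M := fun β h i => by
    have h1 := Finsupp.le_degree i β
    have h2 := MvPolynomial.le_totalDegree h
    change β.degree ≤ P.totalDegree at h2
    omega
  set K := Fintype.piFinset fun _ : ι => Finset.range M with hK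
  have hcard : (K.card : ℝ) = ∏ _i : ι, (M : ℝ) := by
    rw [hK, Fintype.card_piFinset]
    simp
  -- Discrete Fourier inversion: summing over $M$-th roots of unity in each coordinate isolates the
  -- coefficient at $\alpha$, with no integral over the torus.
  have key : ∑ k ∈ K, (∏ i, ((ζ ^ α i)⁻¹) ^ k i) *
      MvPolynomial.eval (fun i => (r i : ℂ) * ζ ^ k i) P =
      P.coeff α * (∏ i, (r i : ℂ) ^ α i) * ∏ _i : ι, (M : ℂ) := by
    simp only [MvPolynomial.eval_eq', Finset.mul_sum]
    rw [Finset.sum_comm]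
    have hin : ∀ β ∈ P.support, ∑ k ∈ K, (∏ i, ((ζ ^ α i)⁻¹) ^ k i) *
        (P.coeff β * ∏ i, ((r i : ℂ) * ζ ^ k i) ^ β i) =
        P.coeff β * (∏ i, (r i : ℂ) ^ β i) * ∏ i, if β i = α i then (M : ℂ) else 0 := by
      intro β hβ'
      have : ∏ i, (if β i = α i then (M : ℂ) else 0) =
          ∏ i, ∑ k ∈ Finset.range M, (ζ ^ β i * (ζ ^ α i)⁻¹) ^ k :=
        Finset.prod_congr rfl fun i _ => (sum_pow_rootOfUnity hζ (hβ β hβ' i) (hα i)).symm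
      rw [this, Finset.prod_univ_sum, Finset.mul_sum]
      refine Finset.sum_congr rfl fun k _ => ?_
      simp only [mul_pow, Finset.prod_mul_distrib, ← pow_mul]
      simp only [mul_comm (k _)]
      ring
    rw [Finset.sum_congr rfl hin, Finset.sum_eq_single α]
    · simp
    · intro β _ hne
      obtain ⟨i, hi⟩ := Finsupp.ne_iff.mp hne
      exact mul_eq_zero_of_right _ (Finset.prod_eq_zero (Finset.mem_univ i) (if_neg hi))
    · intro h
      rw [MvPolynomial.notMem_support_iff.mp h, zero_mul, zero_mul]
  have hpos : (0 : ℝ) < ∏ _i : ι, (M : ℝ) := Finset.prod_pos fun _ _ => by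
    exact_mod_cast Nat.pos_of_ne_zero hM
  have hle : ‖P.coeff α * (∏ i, (r i : ℂ) ^ α i) * ∏ _i : ι, (M : ℂ)‖ ≤
      (∏ _i : ι, (M : ℝ)) * C := by
    rw [← key, ← hcard, ← nsmul_eq_mul]
    refine (norm_sum_le _ _).trans (Finset.sum_le_card_nsmul _ _ _ fun k _ => ?_)
    rw [norm_mul, norm_prod]
    simp only [norm_pow, norm_inv, hζn, one_pow, inv_one, Finset.prod_const_one, one_mul]
    refine hC _ fun i => ?_
    rw [norm_mul, norm_pow, hζn, one_pow, mul_one, Complex.norm_real, Real.norm_of_nonneg (hr i)]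
  rw [norm_mul, norm_mul, norm_prod, norm_prod] at hle
  simp only [norm_pow, Complex.norm_real, Complex.norm_natCast,
    fun i => Real.norm_of_nonneg (hr i)] at hle
  rw [mul_comm] at hle
  exact le_of_mul_le_mul_left hle hpos

/-- A monomial on the unit sphere is largest where the squared coordinates are proportional to the
exponents. -/
lemma prod_pow_le_prod_sqrt_pow {ι : Type*} [Fintype ι] (x : ι → ℝ) (hx : ∀ i, 0 ≤ x i)
    (hsum : ∑ i, x i ^ 2 ≤ 1) {n : ℕ} (hn : n ≠ 0) (β : ι → ℕ) (hβ : ∑ i, β i = n) :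
    ∏ i, x i ^ β i ≤ ∏ i, √((β i : ℝ) / n) ^ β i := by
  have hn0 : (n : ℝ) ≠ 0 := Nat.cast_ne_zero.mpr hn
  have hw : ∀ i, 0 ≤ (β i : ℝ) / n := fun i => by positivity
  -- Weighted AM–GM for $x_i^2/(\beta_i/n)$ with weights $\beta_i/n$. If $\beta_i=0$, the quotient
  -- is $0$ by convention; its factor is $0^0=1$ and its summand is $0$.
  have hamgm := Real.geom_mean_le_arith_mean_weighted Finset.univ (fun i => (β i : ℝ) / n)
    (fun i => x i ^ 2 / ((β i : ℝ) / n)) (fun i _ => hw i)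
    (by rw [← Finset.sum_div, ← Nat.cast_sum, hβ, div_self hn0])
    (fun i _ => div_nonneg (sq_nonneg _) (hw i))
  have h1 : ∏ i, (x i ^ 2 / ((β i : ℝ) / n)) ^ ((β i : ℝ) / n) ≤ 1 := by
    refine hamgm.trans (le_trans (Finset.sum_le_sum fun i _ => ?_) hsum)
    by_cases h : (β i : ℝ) / n = 0
    · rw [h, zero_mul]; positivity
    · rw [mul_div_cancel₀ _ h]
  have h2 : ∏ i, (x i ^ 2 / ((β i : ℝ) / n)) ^ β i ≤ 1 := by
    have h3 := pow_le_one₀ (n := n) (Finset.prod_nonneg fun i _ => Real.rpow_nonneg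
      (div_nonneg (sq_nonneg (x i)) (hw i)) _) h1
    rw [← Finset.prod_pow] at h3
    refine le_of_eq_of_le (Finset.prod_congr rfl fun i _ => ?_) h3
    rw [← Real.rpow_mul_natCast (div_nonneg (sq_nonneg _) (hw i)), div_mul_cancel₀ _ hn0,
      Real.rpow_natCast]
  have h4 : (∏ i, x i ^ β i) ^ 2 ≤ (∏ i, √((β i : ℝ) / n) ^ β i) ^ 2 := by
    have h5 : ∀ i, (x i ^ β i) ^ 2 =
        (x i ^ 2 / ((β i : ℝ) / n)) ^ β i * (√((β i : ℝ) / n) ^ β i) ^ 2 := by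
      intro i
      rw [pow_right_comm, pow_right_comm √_, Real.sq_sqrt (hw i), ← mul_pow]
      by_cases h : β i = 0
      · simp [h]
      · have : (β i : ℝ) ≠ 0 := Nat.cast_ne_zero.mpr h
        congr 1
        field_simp
    rw [← Finset.prod_pow, ← Finset.prod_pow, Finset.prod_congr rfl fun i _ => h5 i,
      Finset.prod_mul_distrib]
    exact mul_le_of_le_one_left (Finset.prod_nonneg fun i _ => sq_nonneg _) h2
  exact (pow_le_pow_iff_left₀ (Finset.prod_nonneg fun i _ => pow_nonneg (hx i) _)
    (Finset.prod_nonneg fun i _ => pow_nonneg (Real.sqrt_nonneg _) _) two_ne_zero).mp h4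

/-! ### Passing between exponents in $d$ variables and homogeneous exponents -/

lemma initExp_injOn {d n : ℕ} {α β : Fin (d + 1) →₀ ℕ} (hα : ∑ j, α j = n) (hβ : ∑ j, β j = n)
    (h : initExp α = initExp β) : α = β := by
  have h' : ∀ j : Fin d, α j.castSucc = β j.castSucc := fun j => DFunLike.congr_fun h j
  rw [Fin.sum_univ_castSucc] at hα hβ
  simp only [h'] at hα
  ext j
  induction j using Fin.lastCases with
  | last => omega
  | cast j => exact h' j

lemma sum_eq_of_mem_support {d n : ℕ} {P : MvPolynomial (Fin (d + 1)) ℂ} (hP : P.IsHomogeneous n)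
    {β : Fin (d + 1) →₀ ℕ} (hβ : P.coeff β ≠ 0) : ∑ j, β j = n := by
  rw [← Finsupp.degree_eq_sum]
  by_contra h
  exact hβ (hP.coeff_eq_zero h)

lemma eval_aeval {ι κ : Type*} (v : κ → ℂ) (g : ι → MvPolynomial κ ℂ) (P : MvPolynomial ι ℂ) :
    MvPolynomial.eval v (MvPolynomial.aeval g P) =
      MvPolynomial.eval (fun i => MvPolynomial.eval v (g i)) P := by
  induction P using MvPolynomial.induction_on with
  | C a => rw [MvPolynomial.aeval_C, MvPolynomial.algebraMap_eq, MvPolynomial.eval_C,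
      MvPolynomial.eval_C]
  | add p q hp hq => rw [map_add, map_add, map_add, hp, hq]
  | mul_X p i hp => rw [map_mul, map_mul, map_mul, hp, MvPolynomial.aeval_X, MvPolynomial.eval_X]

/-- The exponent of degree `n` in `d + 1` variables that extends `α`. -/
def homogExp {d : ℕ} (n : ℕ) (α : Fin d →₀ ℕ) : Fin (d + 1) →₀ ℕ :=
  Finsupp.equivFunOnFinite.symm (Fin.snoc (α := fun _ => ℕ) α (n - ∑ j, α j))

@[simp] lemma initExp_homogExp {d : ℕ} (n : ℕ) (α : Fin d →₀ ℕ) :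
    initExp (homogExp n α) = α := by
  ext j
  simp [homogExp]

lemma sum_homogExp {d n : ℕ} {α : Fin d →₀ ℕ} (h : ∑ j, α j ≤ n) : ∑ j, homogExp n α j = n := by
  rw [Fin.sum_univ_castSucc]
  simp [homogExp, h]

lemma sum_initExp_le {d n : ℕ} {β : Fin (d + 1) →₀ ℕ} (h : ∑ j, β j = n) :
    ∑ j, initExp β j ≤ n := by
  rw [Fin.sum_univ_castSucc] at h
  simp only [initExp_apply]
  omega

lemma homogExp_div {d n : ℕ} (hn : n ≠ 0) {α : Fin d →₀ ℕ} (h : ∑ j, α j ≤ n) (j : Fin (d + 1)) :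
    (homogExp n α j : ℝ) / n = barycentric (fun i => (α i : ℝ) / n) j := by
  have hn0 : (n : ℝ) ≠ 0 := Nat.cast_ne_zero.mpr hn
  induction j using Fin.lastCases with
  | last =>
    simp only [homogExp, barycentric, Finsupp.equivFunOnFinite_symm_apply_apply, Fin.snoc_last]
    rw [Nat.cast_sub h, sub_div, div_self hn0, Nat.cast_sum, Finset.sum_div]
  | cast j => simp [homogExp, barycentric]

section

variable {d : ℕ} (x : ProjPoint d) (Y : Module.Basis (Fin (d + 1)) ℂ (Form d 1))
    (hY : Submodule.span ℂ (Set.range fun j : Fin d => Y j.castSucc) = vanishingForms x)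

/-- The form `P(U_1, …, U_{d+1})`. -/
def formOf {n : ℕ} (P : MvPolynomial (Fin (d + 1)) ℂ) (hP : P.IsHomogeneous n) : Form d n :=
  ⟨MvPolynomial.aeval (fun j => (orthoForm Y j : MvPolynomial (Fin (d + 1)) ℂ)) P, by
    have := hP.aeval (R := ℂ) (n := 1)
      (fun j => (orthoForm Y j : MvPolynomial (Fin (d + 1)) ℂ)) fun j => (orthoForm Y j).2
    rwa [one_mul] at this⟩

lemma evalAt_formOf {n : ℕ} {P : MvPolynomial (Fin (d + 1)) ℂ} (hP : P.IsHomogeneous n)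
    (v : Coord d) :
    evalAt (formOf Y P hP) v = MvPolynomial.eval (fun j => evalAt (orthoForm Y j) v) P := by
  exact eval_aeval _ _ P

include hY in
/-- The leading term of `P(U)` comes from the smallest exponent of `P`. -/
lemma exists_isLexLead {n : ℕ} {P : MvPolynomial (Fin (d + 1)) ℂ} (hP : P.IsHomogeneous n)
    (hP0 : P ≠ 0) : ∃ β, P.coeff β ≠ 0 ∧
      HasLeadingTerm x (lastTrivialization x Y hY) (localParams x Y hY) (formOf Y P hP)
        (initExp β) (P.coeff β * ∏ j, (gamma Y j : ℂ) ^ β j) := by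
  -- The minimum is taken after the last entry is dropped; as $P$ is homogeneous, no two of its
  -- exponents then coincide, so the minimum is attained once.
  obtain ⟨β, hβ, hmin⟩ := P.support.exists_min_image (fun β => toLex (initExp β))
    (MvPolynomial.support_nonempty.mpr hP0)
  rw [MvPolynomial.mem_support_iff] at hβ
  refine ⟨β, hβ, ?_⟩
  rw [hasLeadingTerm_iff x Y hY (orthoForm Y) hP _ rfl]
  constructor
  · refine mul_ne_zero hβ (Finset.prod_ne_zero_iff.mpr fun j _ => pow_ne_zero _ ?_)
    exact Complex.ofReal_ne_zero.mpr (gamma_pos Y j).ne'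
  · have h := isLexLead_aeval (fun j i => Y.repr (orthoForm Y j) i)
      (fun i j hij => repr_orthoForm_of_lt Y hij) P β fun δ hδ => by
        rcases (hmin δ hδ).lt_or_eq with h | h
        · exact Or.inr h
        · exact Or.inl (initExp_injOn
            (sum_eq_of_mem_support hP (MvPolynomial.mem_support_iff.mp hδ))
            (sum_eq_of_mem_support hP hβ) (toLex.injective h).symm)
    simpa only [repr_orthoForm_self] using h

include hY in
-- The leading term of $P(U)$ given by `exists_isLexLead` is the only one, so $\alpha$ must come
-- from an exponent of $P$, whose total degree is $n$.
lemma HasLeadingTerm.exists_coeff {n : ℕ} {s : Form d n} {α : Fin d →₀ ℕ} {a : ℂ}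
    (h : HasLeadingTerm x (lastTrivialization x Y hY) (localParams x Y hY) s α a) :
    s ≠ 0 ∧ ∑ j, α j ≤ n ∧ ∃ P : MvPolynomial (Fin (d + 1)) ℂ, ∃ hP : P.IsHomogeneous n,
      s = formOf Y P hP ∧ P.coeff (homogExp n α) ≠ 0 ∧
      a = P.coeff (homogExp n α) * ∏ j, (gamma Y j : ℂ) ^ homogExp n α j := by
  obtain ⟨P, hP, hs⟩ := exists_eq_aeval_orthoForm Y s
  obtain rfl : s = formOf Y P hP := Subtype.ext hs
  have h' := (hasLeadingTerm_iff x Y hY (orthoForm Y) hP _ rfl _ _).mp h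
  have hP0 : P ≠ 0 := by
    rintro rfl
    apply h'.1
    rw [← h'.2.1, map_zero, MvPolynomial.coeff_zero]
  obtain ⟨β, hβ, hlead⟩ := exists_isLexLead x Y hY hP hP0
  have h'' := (hasLeadingTerm_iff x Y hY (orthoForm Y) hP _ rfl _ _).mp hlead
  obtain ⟨rfl, rfl⟩ := h'.2.unique h'.1 h''.2 h''.1
  have hsum := sum_eq_of_mem_support hP hβ
  have hle := sum_initExp_le hsum
  have hβ' : homogExp n (initExp β) = β :=
    initExp_injOn (sum_homogExp hle) hsum (initExp_homogExp _ _)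
  refine ⟨?_, hle, P, hP, rfl, ?_, ?_⟩
  · intro h0
    -- The $U_j$ take arbitrary values simultaneously, so $P(U)=0$ would force $P$ to vanish as a
    -- function.
    have hev : ∀ z : Fin (d + 1) → ℂ, MvPolynomial.eval z P = 0 := by
      intro z
      obtain ⟨Φ, hΦ⟩ := exists_unitary_coordinates Y
      have h1 := evalAt_formOf Y hP (Φ.symm (WithLp.toLp 2 z))
      rw [h0] at h1
      simp only [← hΦ, LinearIsometryEquiv.apply_symm_apply] at h1
      rw [← h1]
      simp [evalAt]
    exact hP0 (MvPolynomial.funext fun z => by rw [hev, map_zero])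
  · rwa [hβ']
  · rw [hβ']

/-- The squared radii $\beta_j/n$ sum to $1$, so the torus lies in the unit sphere, on which the sup
norm controls the values. These radii give the best Cauchy bound for $\beta$, as the monomial case
shows. -/
lemma norm_coeff_mul_le_supNorm {n : ℕ} (hn : n ≠ 0) {P : MvPolynomial (Fin (d + 1)) ℂ}
    (hP : P.IsHomogeneous n) {β : Fin (d + 1) →₀ ℕ} (hβ : ∑ j, β j = n) :
    ‖P.coeff β‖ * ∏ j, √((β j : ℝ) / n) ^ β j ≤ supNorm (formOf Y P hP) := by
  have hn0 : (n : ℝ) ≠ 0 := Nat.cast_ne_zero.mpr hn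
  refine norm_coeff_mul_prod_le P _ (fun _ => Real.sqrt_nonneg _) (fun z hz => ?_) β
  obtain ⟨Φ, hΦ⟩ := exists_unitary_coordinates Y
  have h1 := evalAt_formOf Y hP (Φ.symm (WithLp.toLp 2 z))
  simp only [← hΦ, LinearIsometryEquiv.apply_symm_apply] at h1
  rw [← h1]
  refine norm_evalAt_le_supNorm _ _ ?_
  rw [LinearIsometryEquiv.norm_map, EuclideanSpace.norm_eq, Real.sqrt_eq_one]
  simp only [hz]
  rw [Finset.sum_congr rfl fun j _ => Real.sq_sqrt (show 0 ≤ (β j : ℝ) / n by positivity),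
    ← Finset.sum_div, ← Nat.cast_sum, hβ, div_self hn0]

lemma supNorm_monomial_le {n : ℕ} (hn : n ≠ 0) {β : Fin (d + 1) →₀ ℕ} (hβ : ∑ j, β j = n)
    (hP : (MvPolynomial.monomial β (1 : ℂ)).IsHomogeneous n) :
    supNorm (formOf Y (MvPolynomial.monomial β (1 : ℂ)) hP) ≤ ∏ j, √((β j : ℝ) / n) ^ β j := by
  refine supNorm_le _ (Finset.prod_nonneg fun _ _ => pow_nonneg (Real.sqrt_nonneg _) _)
    fun v hv => ?_
  obtain ⟨Φ, hΦ⟩ := exists_unitary_coordinates Y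
  rw [evalAt_formOf, MvPolynomial.eval_monomial, one_mul, Finsupp.prod_fintype _ _ (by simp),
    norm_prod]
  simp only [← hΦ, norm_pow]
  refine prod_pow_le_prod_sqrt_pow _ (fun _ => norm_nonneg _) ?_ hn _ hβ
  rw [← EuclideanSpace.norm_sq_eq, LinearIsometryEquiv.norm_map, hv, one_pow]

lemma prod_sqrt_pow_pos {ι : Type*} [Fintype ι] {n : ℕ} (hn : n ≠ 0) (β : ι → ℕ) :
    0 < ∏ j, √((β j : ℝ) / n) ^ β j := by
  refine Finset.prod_pos fun j _ => ?_
  rcases Nat.eq_zero_or_pos (β j) with h | h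
  · simp [h]
  · have := Nat.pos_of_ne_zero hn
    positivity

/-- The bound on the degree is that of `HasLeadingTerm.exists_coeff`; each remaining exponent is the
order of a monomial in the $U_j$. -/
lemma ordSet_eq (n : ℕ) : ordSet x (lastTrivialization x Y hY) (localParams x Y hY) n =
    {α | ∑ j, α j ≤ n} := by
  ext α
  constructor
  · rintro ⟨s, _, a, h⟩
    exact (h.exists_coeff x Y hY).2.1
  · intro h
    have hP : (MvPolynomial.monomial (homogExp n α) (1 : ℂ)).IsHomogeneous n :=
      MvPolynomial.isHomogeneous_monomial _ (by rw [Finsupp.degree_eq_sum, sum_homogExp h])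
    obtain ⟨β, hβ, hlead⟩ := exists_isLexLead x Y hY hP (by simp)
    obtain rfl : homogExp n α = β := by
      by_contra hne
      rw [MvPolynomial.coeff_monomial, if_neg hne] at hβ
      exact hβ rfl
    rw [initExp_homogExp] at hlead
    exact ⟨_, (hlead.exists_coeff x Y hY).1, _, hlead⟩

/-- The supremum of `|lead(s)| / ‖s‖` is attained at the monomials in `U_1, …, U_{d+1}`. -/
lemma isGreatest_leadRatios {n : ℕ} (hn : n ≠ 0) {α : Fin d →₀ ℕ} (hα : ∑ j, α j ≤ n) :
    IsGreatest (leadRatios x (lastTrivialization x Y hY) (localParams x Y hY) n α)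
      ((∏ j, gamma Y j ^ homogExp n α j) /
        ∏ j, √((homogExp n α j : ℝ) / n) ^ homogExp n α j) := by
  have hB := prod_sqrt_pow_pos hn (homogExp n α)
  have hG : 0 < ∏ j, gamma Y j ^ homogExp n α j :=
    Finset.prod_pos fun j _ => pow_pos (gamma_pos Y j) _
  have hGn : ‖∏ j, (gamma Y j : ℂ) ^ homogExp n α j‖ = ∏ j, gamma Y j ^ homogExp n α j := by
    rw [norm_prod]
    simp only [norm_pow, Complex.norm_real, fun j => Real.norm_of_nonneg (gamma_pos Y j).le]
  have hub : ∀ r ∈ leadRatios x (lastTrivialization x Y hY) (localParams x Y hY) n α,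
      r ≤ (∏ j, gamma Y j ^ homogExp n α j) /
        ∏ j, √((homogExp n α j : ℝ) / n) ^ homogExp n α j := by
    rintro _ ⟨s, a, h, rfl⟩
    obtain ⟨_, _, P, hP, rfl, hP0, rfl⟩ := h.exists_coeff x Y hY
    have hle := norm_coeff_mul_le_supNorm Y hn hP (sum_homogExp hα)
    have hpos : 0 < supNorm (formOf Y P hP) :=
      (mul_pos (norm_pos_iff.mpr hP0) hB).trans_le hle
    rw [norm_mul, hGn, div_le_div_iff₀ hpos hB, mul_right_comm, mul_comm]
    exact mul_le_mul_of_nonneg_left hle hG.le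
  refine ⟨?_, hub⟩
  have hP : (MvPolynomial.monomial (homogExp n α) (1 : ℂ)).IsHomogeneous n :=
    MvPolynomial.isHomogeneous_monomial _ (by rw [Finsupp.degree_eq_sum, sum_homogExp hα])
  obtain ⟨β, hβ, hlead⟩ := exists_isLexLead x Y hY hP (by simp)
  obtain rfl : homogExp n α = β := by
    by_contra hne
    rw [MvPolynomial.coeff_monomial, if_neg hne] at hβ
    exact hβ rfl
  rw [initExp_homogExp, MvPolynomial.coeff_monomial, if_pos rfl, one_mul] at hlead
  refine ⟨_, _, hlead, ?_⟩
  rw [hGn]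
  congr 1
  refine le_antisymm ?_ (supNorm_monomial_le Y hn (sum_homogExp hα) hP)
  have := norm_coeff_mul_le_supNorm Y hn hP (sum_homogExp hα)
  rwa [MvPolynomial.coeff_monomial, if_pos rfl, norm_one, one_mul] at this

/-! ### The Chebyshev transform at finite level and its continuity -/

/-- The formula for the local Chebyshev transform. -/
def chebyshevFormula (w : Fin d → ℝ) : ℝ :=
  ∑ j, barycentric w j * Real.log (gamma Y j) + 1 / 2 * entropy w

/-- The equality is exact for every $n\ge1$, because the supremum is attained at a monomial whose
norm is known. -/
lemma log_leadSup {n : ℕ} (hn : n ≠ 0) {α : Fin d →₀ ℕ} (hα : ∑ j, α j ≤ n) :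
    1 / (n : ℝ) * Real.log (leadSup x (lastTrivialization x Y hY) (localParams x Y hY) n α) =
      chebyshevFormula Y fun j => (α j : ℝ) / n := by
  have hB := prod_sqrt_pow_pos hn (homogExp n α)
  have hG : 0 < ∏ j, gamma Y j ^ homogExp n α j :=
    Finset.prod_pos fun j _ => pow_pos (gamma_pos Y j) _
  -- Nonvanishing holds also when the exponent is $0$, where the factor is $0^0=1$.
  have hsqrt : ∀ j, √((homogExp n α j : ℝ) / n) ^ homogExp n α j ≠ 0 := fun j h =>
    hB.ne' (Finset.prod_eq_zero (Finset.mem_univ j) h)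
  rw [leadSup, (isGreatest_leadRatios x Y hY hn hα).csSup_eq, Real.log_div hG.ne' hB.ne',
    Real.log_prod fun j _ => (pow_pos (gamma_pos Y j) _).ne', Real.log_prod fun j _ => hsqrt j,
    chebyshevFormula, entropy, mul_sub, sub_eq_add_neg, Finset.mul_sum, Finset.mul_sum,
    Finset.mul_sum, ← Finset.sum_neg_distrib]
  simp only [← homogExp_div hn hα]
  congr 1
  · refine Finset.sum_congr rfl fun j _ => ?_
    rw [Real.log_pow]
    ring
  · refine Finset.sum_congr rfl fun j _ => ?_
    rw [Real.log_pow, Real.log_sqrt (by positivity), one_div ((_ : ℝ) / _), Real.log_inv]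
    ring

/-- With the convention $0\log\frac10=0$ the function $-u\log u$ is continuous at $0$ too, so
boundary points of the simplex need no separate argument. -/
lemma continuous_chebyshevFormula : Continuous (chebyshevFormula Y) := by
  have hb : ∀ j, Continuous fun w : Fin d → ℝ => barycentric w j := by
    intro j
    induction j using Fin.lastCases with
    | last => simp only [barycentric, Fin.snoc_last]; fun_prop
    | cast j => simp only [barycentric, Fin.snoc_castSucc]; fun_prop
  have he : Continuous (entropy : (Fin d → ℝ) → ℝ) := by
    have : (entropy : (Fin d → ℝ) → ℝ) = fun w => ∑ j, Real.negMulLog (barycentric w j) := by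
      funext w
      simp [entropy, Real.negMulLog]
    rw [this]
    exact continuous_finsetSum _ fun j _ => Real.continuous_negMulLog.comp (hb j)
  exact (continuous_finsetSum _ fun j _ => (hb j).mul continuous_const).add
    (continuous_const.mul he)

end

/-! ### The Okounkov body and approximation by lattice points -/

lemma isClosed_simplex (d : ℕ) :
    IsClosed {α : Fin d → ℝ | (∀ j, 0 ≤ α j) ∧ ∑ j, α j ≤ 1} := by
  have hsum : Continuous fun α : Fin d → ℝ => ∑ j, α j := by fun_prop
  have hpos : IsClosed {α : Fin d → ℝ | ∀ j, 0 ≤ α j} := by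
    rw [Set.ofPred_forall]
    exact isClosed_iInter fun j => isClosed_le continuous_const (continuous_apply j)
  exact hpos.inter (isClosed_le hsum continuous_const)

/-- Points of the simplex are limits of rational points with denominator `n`. -/
lemma exists_tendsto_div {d : ℕ} {w : Fin d → ℝ} (h0 : ∀ j, 0 ≤ w j) (h1 : ∑ j, w j ≤ 1) :
    ∃ α : ℕ → Fin d →₀ ℕ, (∀ n, ∑ j, α n j ≤ n) ∧
      Filter.Tendsto (fun (n : ℕ) (j : Fin d) => (α n j : ℝ) / n) Filter.atTop (nhds w) := by
  -- Rounding $nw_j$ down keeps the total degree at most $n$.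
  refine ⟨fun n => Finsupp.equivFunOnFinite.symm fun j => ⌊w j * n⌋₊, fun n => ?_, ?_⟩
  · have : ((∑ j, ⌊w j * n⌋₊ : ℕ) : ℝ) ≤ n := by
      push_cast
      calc ∑ j, (⌊w j * n⌋₊ : ℝ) ≤ ∑ j, w j * n :=
            Finset.sum_le_sum fun j _ => Nat.floor_le (mul_nonneg (h0 j) n.cast_nonneg)
        _ = (∑ j, w j) * n := by rw [Finset.sum_mul]
        _ ≤ n := mul_le_of_le_one_left n.cast_nonneg h1
    exact_mod_cast this
  · rw [tendsto_pi_nhds]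
    intro j
    exact (tendsto_nat_floor_mul_div_atTop (h0 j)).comp tendsto_natCast_atTop_atTop

lemma okounkovBody_eq {d : ℕ} (x : ProjPoint d) (Y : Module.Basis (Fin (d + 1)) ℂ (Form d 1))
    (hY : Submodule.span ℂ (Set.range fun j : Fin d => Y j.castSucc) = vanishingForms x) :
    okounkovBody x (lastTrivialization x Y hY) (localParams x Y hY) =
      {α : Fin d → ℝ | (∀ j, 0 ≤ α j) ∧ ∑ j, α j ≤ 1} := by
  apply subset_antisymm
  · refine closure_minimal ?_ (isClosed_simplex d)
    rintro _ ⟨n, hn, α, hα, rfl⟩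
    rw [ordSet_eq] at hα
    refine ⟨fun j => by positivity, ?_⟩
    have hn0 : (0 : ℝ) < n := by exact_mod_cast hn
    rw [← Finset.sum_div, div_le_one hn0, ← Nat.cast_sum]
    exact_mod_cast hα
  · rintro w ⟨h0, h1⟩
    obtain ⟨α, hα, hlim⟩ := exists_tendsto_div h0 h1
    refine mem_closure_of_tendsto hlim ?_
    filter_upwards [Filter.eventually_ge_atTop 1] with n hn
    exact ⟨n, hn, α n, by rw [ordSet_eq]; exact hα n, rfl⟩

end FubiniStudy

end

theorem mainTheorem10 (d : ℕ) (x : FubiniStudy.ProjPoint d)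
    (Y : Module.Basis (Fin (d + 1)) ℂ (FubiniStudy.Form d 1))
    (hY : Submodule.span ℂ (Set.range fun j : Fin d => Y j.castSucc) =
      FubiniStudy.vanishingForms x) :
    FubiniStudy.okounkovBody x (FubiniStudy.lastTrivialization x Y hY)
        (FubiniStudy.localParams x Y hY) =
      {α : Fin d → ℝ | (∀ j, 0 ≤ α j) ∧ ∑ j, α j ≤ 1} ∧
    (∀ j, 0 < FubiniStudy.gamma Y j) ∧
    (∀ n : ℕ, 1 ≤ n → ∀ α ∈ FubiniStudy.ordSet x (FubiniStudy.lastTrivialization x Y hY)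
        (FubiniStudy.localParams x Y hY) n,
      BddAbove (FubiniStudy.leadRatios x (FubiniStudy.lastTrivialization x Y hY)
        (FubiniStudy.localParams x Y hY) n α)) ∧
    ∀ α ∈ FubiniStudy.okounkovBody x (FubiniStudy.lastTrivialization x Y hY)
        (FubiniStudy.localParams x Y hY),
      FubiniStudy.HasChebyshevTransformAt x (FubiniStudy.lastTrivialization x Y hY)
        (FubiniStudy.localParams x Y hY) α
        (∑ j, FubiniStudy.barycentric α j * Real.log (FubiniStudy.gamma Y j) +
          1 / 2 * FubiniStudy.entropy α) := by
  refine ⟨FubiniStudy.okounkovBody_eq x Y hY, FubiniStudy.gamma_pos Y, ?_, ?_⟩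
  · intro n hn α hα
    rw [FubiniStudy.ordSet_eq] at hα
    exact (FubiniStudy.isGreatest_leadRatios x Y hY (by omega) hα).bddAbove
  · intro w hw
    rw [FubiniStudy.okounkovBody_eq] at hw
    constructor
    · obtain ⟨α, hα, hlim⟩ := FubiniStudy.exists_tendsto_div hw.1 hw.2
      exact ⟨α, fun n _ => by rw [FubiniStudy.ordSet_eq]; exact hα n, hlim⟩
    · intro α hα hlim
      -- For $n\ge1$ the sequence equals the continuous formula evaluated at $\alpha_n/n$.
      refine Filter.Tendsto.congr' ?_
        (((FubiniStudy.continuous_chebyshevFormula Y).tendsto w).comp hlim)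
      filter_upwards [Filter.eventually_ge_atTop 1] with n hn
      have h := hα n hn
      rw [FubiniStudy.ordSet_eq] at h
      exact (FubiniStudy.log_leadSup x Y hY (by omega) h).symm
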